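/- **Setting.** Let $S,A$ be finite, and let $(S,A,P,r,u,b,\gamma,\rho)$ be a discounted constrained Markov decision process with transition kernel $P(s'\mid s,a)$, reward and utility $r,u:S\times A\to[0,1]$, discount $\gamma\in[0,1)$, threshold $b\in(0,1/(1-\gamma)]$ and initial distribution $\rho$ on $S$. For a stationary stochastic policy $\pi$ and $f:S\times A\to\mathbb R$ let $V_f^\pi(\rho)=\mathbb E\big[\sum_{t\ge0}\gamma^t f(s_t,a_t)\big]$, where $s_0\sim\rho$, $a_t\sim\pi(\cdot\mid s_t)$, $s_{t+1}\sim P(\cdot\mid s_t,a_t)$, and put $g=u-(1-\gamma)b$. An optimal policy $\pi^\star$ maximizes $V_r^\pi(\rho)$ over all policies with $V_u^\pi(\rho)\ge b$. Assume that $V_g^{\bar\pi}(\rho)\ge\xi$ for some policy $\bar\pi$ and some $\xi>0$. For $q\in\mathbb R^{S\times A}$, $\lambda\in\mathbb R$, $\mu\in\mathbb R^S$ let $$L(q,\lambda,\mu)=\langle r+\lambda g,q\rangle+\sum_{s}\mu(s)\Big(\rho(s)-\sum_a q(s,a)+\gamma\sum_{s',a'}P(s\mid s',a')q(s',a')\Big).$$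 Let $Q=\{q: 0\le q(s,a)\le\frac1{1-\gamma}\ \forall s,a\}$, $\Lambda=[0,\frac1{(1-\gamma)\xi}]$, $M=\{\mu:|\mu(s)|\le\frac{1-\gamma+1/\xi}{(1-\gamma)^2}\ \forall s\}$, $Z=Q\times\Lambda\times M$, and let $Z^\star$ be the set of saddle points of $L$ over $Z$ (maximum over $q\in Q$, minimum over $(\lambda,\mu)\in\Lambda\times M$). All norms are Euclidean, $\mathcal P_X(x)=\operatorname{argmin}_{x'\in X}\|x'-x\|$, $\operatorname{dist}^2(z,X)=\|z-\mathcal P_X(z)\|^2$, and $F=(-\nabla_qL,\nabla_{(\lambda,\mu)}L)$. Let $L_f$ be a Lipschitz constant of $F$ on $Z$. The optimistic primal-dual method (OPD) with stepsize $\eta>0$ starts at any $z_0=\hat z_1\in Z$ and iterates, for $t\ge1$, $$z_t=\mathcal P_Z(\hat z_t-\eta F(z_{t-1})),\qquad \hat z_{t+1}=\mathcal P_Z(\hat z_t-\eta F(z_t)).$$ **Theorem (linear convergence of OPD).** $Z^\star$ is nonempty, and there is a constant $C>0$, depending only on the problem (including $\xi$), such that whenever $0<\eta<\frac1{8L_f}$,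 for every starting point and every $t\ge0$, $$\operatorname{dist}^2(z_t,Z^\star)\le C_1\Big(\frac1{1+C_2}\Big)^t,\qquad C_1=64\operatorname{dist}^2(\hat z_1,Z^\star),\quad C_2=\min\Big(\frac{16\eta^2C^2}{81},\frac12\Big).$$ **Corollary (nearly optimal constrained policy).** Suppose $\rho_{\min}=\min_s\rho(s)>0$, and run OPD with $Q$ replaced by $\{q: 0\le q(s,a)\le\frac1{1-\gamma},\ \sum_{a'}q(s,a')\ge\rho_{\min}\ \forall s,a\}$ (in $Z$, and hence in $L_f$), again with $0<\eta<\frac1{8L_f}$. Then an optimal policy $\pi^\star$ exists, and there is a constant $K>0$, depending only on the problem (including $\xi$), such that for every starting point, every $\epsilon\in(0,\frac12]$ and every $t\ge\frac{K}{\eta^2}\log^2\frac1\epsilon$, $\pi_t(a\mid s)=q_t(s,a)/\sum_{a'}q_t(s,a')$ is a policy with $$V_r^{\pi^\star}(\rho)-V_r^{\pi_t}(\rho)\le\epsilon\qquad\text{and}\qquad -V_g^{\pi_t}(\rho)\le\epsilon .$$ -/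

import Mathlib

open scoped NNReal

/-- A finite discounted constrained Markov decision process
`(S, A, P, r, u, b, γ, ρ)`; `P s a s'` is the probability of moving from `s` to `s'` under `a`. -/
structure CMDP (S A : Type*) [Fintype S] [Fintype A] where
  P : S → A → S → ℝ
  P_nonneg : ∀ s a s', 0 ≤ P s a s'
  P_sum : ∀ s a, ∑ s', P s a s' = 1
  r : S → A → ℝ
  r_mem : ∀ s a, r s a ∈ Set.Icc (0 : ℝ) 1
  u : S → A → ℝ
  u_mem : ∀ s a, u s a ∈ Set.Icc (0 : ℝ) 1
  γ : ℝ
  γ_nonneg : 0 ≤ γ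
  γ_lt_one : γ < 1
  b : ℝ
  b_pos : 0 < b
  b_le : b ≤ 1 / (1 - γ)
  ρ : S → ℝ
  ρ_nonneg : ∀ s, 0 ≤ ρ s
  ρ_sum : ∑ s, ρ s = 1

/-- A stationary stochastic policy; `π s a` is the probability `π(a | s)`. -/
def IsPolicy {S A : Type*} [Fintype A] (π : S → A → ℝ) : Prop :=
  ∀ s, (∀ a, 0 ≤ π s a) ∧ ∑ a, π s a = 1

/-- The Euclidean space of primal-dual triples `z = (q, lam, mu)`, with
`q ∈ ℝ^(S × A)`, `lam ∈ ℝ` and `mu ∈ ℝ^S`. -/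
abbrev PrimalDual (S A : Type*) := EuclideanSpace ℝ ((S × A) ⊕ (Unit ⊕ S))

namespace PrimalDual

variable {S A : Type*}

/-- The primal component `q`. -/
def q (z : PrimalDual S A) : S → A → ℝ := fun s a => z (Sum.inl (s, a))

/-- The multiplier of the utility constraint. -/
def lam (z : PrimalDual S A) : ℝ := z (Sum.inr (Sum.inl ()))

/-- The multiplier of the Bellman flow equations. -/
def mu (z : PrimalDual S A) : S → ℝ := fun s => z (Sum.inr (Sum.inr s))

end PrimalDual

/-- The metric projection of `x` onto `X`: a minimizer of `‖x' - x‖` over `x' ∈ X`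
(unique when `X` is nonempty, closed and convex). -/
noncomputable def metricProj {E : Type*} [NormedAddCommGroup E] (X : Set E) (x : E) : E :=
  Classical.epsilon (fun p => p ∈ X ∧ ∀ x' ∈ X, ‖p - x‖ ≤ ‖x' - x‖)

/-- The squared distance `‖x - 𝒫_X(x)‖²` of `x` to `X`. -/
noncomputable def distSq {E : Type*} [NormedAddCommGroup E] (x : E) (X : Set E) : ℝ :=
  ‖x - metricProj X x‖ ^ 2

namespace CMDP

variable {S A : Type*} [Fintype S] [Fintype A]

/-- `Pr(s_t = s | π, s_0)`. -/
noncomputable def stateProb (M : CMDP S A) (π : S → A → ℝ) (s₀ : S) : ℕ → S → ℝ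
  | 0 => fun s => open Classical in if s = s₀ then 1 else 0
  | t + 1 => fun s' => ∑ s, ∑ a, M.stateProb π s₀ t s * π s a * M.P s a s'

/-- `V_f^π(s₀) = 𝔼[∑_t γ^t f(s_t, a_t) | s_0 = s₀]`, where
`Pr(s_t = s, a_t = a) = Pr(s_t = s) π(a | s)`. -/
noncomputable def value (M : CMDP S A) (f π : S → A → ℝ) (s₀ : S) : ℝ :=
  ∑' t : ℕ, M.γ ^ t * ∑ s, ∑ a, M.stateProb π s₀ t s * π s a * f s a

/-- `V_f^π(ρ) = 𝔼_{s ∼ ρ}[V_f^π(s)]`. -/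
noncomputable def valueRho (M : CMDP S A) (f π : S → A → ℝ) : ℝ :=
  ∑ s, M.ρ s * M.value f π s

/-- `g = u - (1 - γ) b`. -/
def g (M : CMDP S A) : S → A → ℝ := fun s a => M.u s a - (1 - M.γ) * M.b

/-- `π` solves: maximize `V_r^π(ρ)` over all policies subject to `V_u^π(ρ) ≥ b`. -/
def IsOptimalPolicy (M : CMDP S A) (π : S → A → ℝ) : Prop :=
  IsPolicy π ∧ M.b ≤ M.valueRho M.u π ∧
    ∀ π' : S → A → ℝ, IsPolicy π' → M.b ≤ M.valueRho M.u π' →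
      M.valueRho M.r π' ≤ M.valueRho M.r π

/-- Strict feasibility with slack `ξ`: some policy has `V_g^π(ρ) ≥ ξ`. -/
def Feasible (M : CMDP S A) (ξ : ℝ) : Prop :=
  ∃ π : S → A → ℝ, IsPolicy π ∧ ξ ≤ M.valueRho M.g π

/-- `ρ_min = min_s ρ(s)`. -/
noncomputable def rhoMin (M : CMDP S A) : ℝ := ⨅ s, M.ρ s

/-- The Lagrangian `L(q, λ, μ) = ⟨r + λ g, q⟩ + μᵀ (ρ - (E - γ P)ᵀ q)`. -/
noncomputable def lagrangian (M : CMDP S A) (q : S → A → ℝ) (lam : ℝ) (mu : S → ℝ) : ℝ :=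
  ∑ s, ∑ a, (M.r s a + lam * M.g s a) * q s a +
    ∑ s, mu s * (M.ρ s - (∑ a, q s a - M.γ * ∑ s', ∑ a', M.P s' a' s * q s' a'))

/-- `F = (-∇_q L, ∇_(λ, μ) L)`. -/
noncomputable def gradField (M : CMDP S A) (z : PrimalDual S A) : PrimalDual S A :=
  WithLp.toLp 2 (Sum.elim
    (fun x => -(gradient (fun w : PrimalDual S A => M.lagrangian w.q w.lam w.mu) z) (Sum.inl x))
    (fun y => (gradient (fun w : PrimalDual S A => M.lagrangian w.q w.lam w.mu) z) (Sum.inr y)))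

/-- `Q = {q | 0 ≤ q(s,a) ≤ 1/(1-γ)}`. -/
def Qbox (M : CMDP S A) : Set (S → A → ℝ) :=
  {q | ∀ s a, 0 ≤ q s a ∧ q s a ≤ 1 / (1 - M.γ)}

/-- The smaller polytope of those `q ∈ Q` with `∑_a q(s,a) ≥ ρ_min` for all `s`. -/
def QboxMin (M : CMDP S A) : Set (S → A → ℝ) :=
  {q | q ∈ M.Qbox ∧ ∀ s, M.rhoMin ≤ ∑ a, q s a}

/-- `Λ = [0, 1/((1-γ)ξ)]`. -/
def lamSet (M : CMDP S A) (ξ : ℝ) : Set ℝ := Set.Icc 0 (1 / ((1 - M.γ) * ξ))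

/-- `{μ | |μ(s)| ≤ μ_max for all s}` with `μ_max = (1 - γ + 1/ξ)/(1-γ)²`. -/
def muSet (M : CMDP S A) (ξ : ℝ) : Set (S → ℝ) :=
  {mu | ∀ s, |mu s| ≤ (1 - M.γ + 1 / ξ) / (1 - M.γ) ^ 2}

/-- The domain `Z`, the product of `Q`, `Λ` and the set of the `μ`. -/
def domain (M : CMDP S A) (Q : Set (S → A → ℝ)) (ξ : ℝ) : Set (PrimalDual S A) :=
  {z | z.q ∈ Q ∧ z.lam ∈ M.lamSet ξ ∧ z.mu ∈ M.muSet ξ}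

/-- The set `Z⋆` of saddle points of `L` over `Z` (max over `q`, min over `(λ, μ)`). -/
def saddleSet (M : CMDP S A) (Q : Set (S → A → ℝ)) (ξ : ℝ) : Set (PrimalDual S A) :=
  {z | z ∈ M.domain Q ξ ∧
    (∀ q' ∈ Q, M.lagrangian q' z.lam z.mu ≤ M.lagrangian z.q z.lam z.mu) ∧
    (∀ lam' ∈ M.lamSet ξ, ∀ mu' ∈ M.muSet ξ,
      M.lagrangian z.q z.lam z.mu ≤ M.lagrangian z.q lam' mu')}

/-- The pair `(z_t, ẑ_{t+1})` of the optimistic primal-dual method on `Z` with stepsize `η`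
started at `z_0 = ẑ_1 = z₁`. -/
noncomputable def opdPair (M : CMDP S A) (Z : Set (PrimalDual S A)) (η : ℝ)
    (z₁ : PrimalDual S A) : ℕ → PrimalDual S A × PrimalDual S A
  | 0 => (z₁, z₁)
  | t + 1 =>
    let zprev := (M.opdPair Z η z₁ t).1
    let zhat := (M.opdPair Z η z₁ t).2
    let znew := metricProj Z (zhat - η • M.gradField zprev)
    (znew, metricProj Z (zhat - η • M.gradField znew))

/-- The iterate `z_t` of the optimistic primal-dual method. -/
noncomputable def opd (M : CMDP S A) (Z : Set (PrimalDual S A)) (η : ℝ)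
    (z₁ : PrimalDual S A) (t : ℕ) : PrimalDual S A :=
  (M.opdPair Z η z₁ t).1

end CMDP

/-- The policy `π(a | s) = q(s,a) / ∑_{a'} q(s,a')` recovered from `q`. -/
noncomputable def recoveredPolicy {S A : Type*} [Fintype A] (q : S → A → ℝ) : S → A → ℝ :=
  fun s a => q s a / ∑ a', q s a'

/-! ### Metric projections onto compact convex sets. -/

section Projection

variable {E : Type*} [NormedAddCommGroup E]

/-! The Lagrangian is biaffine, so pairing `F z` with `z - w` gives exactly the duality gap `G z w =
L(w.q, z.lam, z.mu) - L(z.q, w.lam, w.mu)` (`inner_gradField`), and saddle points are the `z ∈ Z`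
with `G z w ≤ 0` for all `w ∈ Z`. Since `G z` is affine on a polytope, finitely many vertices `w`
suffice to test this, so the saddle set is itself a polytope. Hoffman's error bound then makes the
worst gap at least a constant times the distance to that set
(`IsPolyhedral.exists_pos_mul_norm_le_gap`).

Conversely, optimality of the projections bounds the gap at the new point by the displacement of one
step (`optimistic_step_gap`), while `optimistic_step_energy` pays for the squared displacement by a
decrease of the energy `dist² + ‖ẑ - z‖² / 16`. The displacement therefore dominates the distance,
and the energy contracts geometrically (`optimistic_linear_convergence`).

Saddle points come from linear programming duality over occupancy measures: Sion's theorem handles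
the utility constraint, and the Bellman optimality equation supplies `mu`. The multipliers so found
stay strictly below the upper bound on `lam` and strictly inside the box for `mu`
(`exists_optimal_triple`). This slack forces the primal part of every saddle point to satisfy the
flow equations and the utility constraint exactly, and to be optimal
(`exists_optimal_value_saddleSet`).

For the corollary, the value of a recovered policy differs from the linear objective by at most a
multiple of the flow violation, hence of the distance to a saddle point. A positive lower bound on
all admissible `Lf` (`exists_pos_le_lipschitz`) bounds `η` above, so the rate constant is at least a
fixed multiple of `η ^ 2`. -/

theorem metricProj_mem_and_forall_norm_le {X : Set E} (hc : IsCompact X) (hne : X.Nonempty)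
    (x : E) : metricProj X x ∈ X ∧ ∀ x' ∈ X, ‖metricProj X x - x‖ ≤ ‖x' - x‖ := by
  obtain ⟨p, hp, hmin⟩ := hc.exists_isMinOn hne
    (f := fun y => ‖y - x‖) (by fun_prop)
  exact Classical.epsilon_spec (p := fun p => p ∈ X ∧ ∀ x' ∈ X, ‖p - x‖ ≤ ‖x' - x‖)
    ⟨p, hp, fun x' hx' => hmin hx'⟩

theorem metricProj_mem {X : Set E} (hc : IsCompact X) (hne : X.Nonempty) (x : E) :
    metricProj X x ∈ X :=
  (metricProj_mem_and_forall_norm_le hc hne x).1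

theorem distSq_le {X : Set E} (hc : IsCompact X) (x : E) {w : E} (hw : w ∈ X) :
    distSq x X ≤ ‖x - w‖ ^ 2 := by
  have h := (metricProj_mem_and_forall_norm_le hc ⟨w, hw⟩ x).2 w hw
  rw [norm_sub_rev _ x, norm_sub_rev w x] at h
  exact pow_le_pow_left₀ (norm_nonneg _) h 2

variable [InnerProductSpace ℝ E]

theorem inner_sub_metricProj_nonpos {X : Set E} (hc : IsCompact X) (hconv : Convex ℝ X)
    (x : E) {w : E} (hw : w ∈ X) :
    inner ℝ (x - metricProj X x) (w - metricProj X x) ≤ 0 := by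
  obtain ⟨hmem, hmin⟩ := metricProj_mem_and_forall_norm_le hc ⟨w, hw⟩ x
  refine (norm_eq_iInf_iff_real_inner_le_zero hconv hmem).1 ?_ w hw
  have : Nonempty X := ⟨⟨w, hw⟩⟩
  refine le_antisymm (le_ciInf fun y => ?_) (ciInf_le ⟨0, ?_⟩ (⟨_, hmem⟩ : X))
  · rw [norm_sub_rev x, norm_sub_rev x]
    exact hmin y y.2
  · rintro _ ⟨y, rfl⟩
    exact norm_nonneg _

end Projection

/-! ### The optimistic gradient method for an abstract variational inequality. -/

section Optimistic

variable {E : Type*} [NormedAddCommGroup E] [InnerProductSpace ℝ E]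

/-- The energy inequality for one step of the optimistic gradient method. -/
theorem optimistic_step_energy {Z : Set E} (hc : IsCompact Z) (hconv : Convex ℝ Z) {F : E → E}
    {L : ℝ≥0} (hL : LipschitzOnWith L F Z) {η : ℝ} (hη : 0 < η) (hηL : η * L ≤ 1 / 8)
    {p zp z p' : E} (hzp : zp ∈ Z)
    (hz : z = metricProj Z (p - η • F zp)) (hp' : p' = metricProj Z (p - η • F z))
    {w : E} (hw : w ∈ Z) :
    2 * η * inner ℝ (F z) (z - w) + ‖p' - w‖ ^ 2 + 1 / 16 * ‖p' - z‖ ^ 2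
      + 15 / 16 * (‖p' - z‖ ^ 2 + ‖z - p‖ ^ 2) ≤ ‖p - w‖ ^ 2 + 1 / 16 * ‖p - zp‖ ^ 2 := by
  have hzZ : z ∈ Z := hz ▸ metricProj_mem hc ⟨w, hw⟩ _
  have hpZ : p' ∈ Z := hp' ▸ metricProj_mem hc ⟨w, hw⟩ _
  have h1 := inner_sub_metricProj_nonpos hc hconv (p - η • F z) hw
  have h2 := inner_sub_metricProj_nonpos hc hconv (p - η • F zp) hpZ
  have h3 := inner_sub_metricProj_nonpos hc hconv (p - η • F z) hzZ
  rw [← hp'] at h1 h3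
  rw [← hz] at h2
  -- Add the optimality conditions of the two projections, each tested at the other's output.
  have key : ‖z - p'‖ ^ 2 ≤ η * inner ℝ (F z - F zp) (z - p') := by
    rw [← real_inner_self_eq_norm_sq]
    simp only [inner_sub_left, inner_sub_right, inner_smul_left, conj_trivial] at *
    linarith [real_inner_comm z p']
  have hF : ‖F z - F zp‖ ≤ L * ‖z - zp‖ := by
    simpa [dist_eq_norm] using hL.dist_le_mul z hzZ zp hzp
  have hcs := real_inner_le_norm (F z - F zp) (z - p')
  have hn1 : ‖z - p'‖ ≤ 1 / 8 * ‖z - zp‖ := by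
    by_cases h0 : ‖z - p'‖ = 0
    · rw [h0]; positivity
    · have hpos : 0 < ‖z - p'‖ := lt_of_le_of_ne (norm_nonneg _) (Ne.symm h0)
      have : ‖z - p'‖ * ‖z - p'‖ ≤ (1 / 8 * ‖z - zp‖) * ‖z - p'‖ := by
        calc ‖z - p'‖ * ‖z - p'‖ = ‖z - p'‖ ^ 2 := by ring
          _ ≤ η * (‖F z - F zp‖ * ‖z - p'‖) := key.trans (by gcongr)
          _ ≤ η * (L * ‖z - zp‖ * ‖z - p'‖) := by gcongr
          _ = (η * L) * (‖z - zp‖ * ‖z - p'‖) := by ring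
          _ ≤ 1 / 8 * (‖z - zp‖ * ‖z - p'‖) := by gcongr
          _ = _ := by ring
      exact le_of_mul_le_mul_right this hpos
  have hn2 : η * inner ℝ (F z - F zp) (z - p') ≤ 1 / 64 * ‖z - zp‖ ^ 2 := by
    calc η * inner ℝ (F z - F zp) (z - p') ≤ η * (‖F z - F zp‖ * ‖z - p'‖) := by gcongr
      _ ≤ η * ((L * ‖z - zp‖) * (1 / 8 * ‖z - zp‖)) := by gcongr
      _ = (η * L) * (1 / 8 * ‖z - zp‖ ^ 2) := by ring
      _ ≤ 1 / 8 * (1 / 8 * ‖z - zp‖ ^ 2) := by gcongr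
      _ = _ := by ring
  have hn3 : ‖z - zp‖ ^ 2 ≤ 2 * ‖z - p‖ ^ 2 + 2 * ‖p - zp‖ ^ 2 := by
    have : ‖z - zp‖ ≤ ‖z - p‖ + ‖p - zp‖ := by
      simpa using norm_add_le (z - p) (p - zp)
    nlinarith [norm_nonneg (z - zp), sq_nonneg (‖z - p‖ - ‖p - zp‖)]
  -- The right side is nonnegative by `h1` and `h2`. Only the inner product of `hn2` has to be
  -- absorbed; with `hn3` it costs `2 * (1/64) * 2 = 1/16` of `‖z - p‖ ^ 2` and of `‖p - zp‖ ^ 2`.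
  have e1 : ‖p - w‖ ^ 2 - ‖p' - w‖ ^ 2 - ‖p' - z‖ ^ 2 - ‖z - p‖ ^ 2
      + 2 * η * inner ℝ (F z - F zp) (z - p') - 2 * η * inner ℝ (F z) (z - w)
      = -2 * inner ℝ (p - η • F z - p') (w - p') - 2 * inner ℝ (p - η • F zp - z) (p' - z) := by
    simp only [← real_inner_self_eq_norm_sq]
    simp only [inner_sub_left, inner_sub_right, inner_smul_left, conj_trivial]
    linarith [real_inner_comm p w, real_inner_comm p' w, real_inner_comm p p',
      real_inner_comm z p', real_inner_comm z p]
  linarith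

/-- The displacement in one step of the optimistic gradient method controls the gap. -/
theorem optimistic_step_gap {Z : Set E} (hc : IsCompact Z) (hconv : Convex ℝ Z) {F : E → E}
    {L : ℝ≥0} (hL : LipschitzOnWith L F Z) {η : ℝ} (hη : 0 < η) (hηL : η * L ≤ 1 / 8)
    {p z p' : E} (hzZ : z ∈ Z) (hp' : p' = metricProj Z (p - η • F z))
    {w : E} (hw : w ∈ Z) :
    η * inner ℝ (F p') (p' - w) ≤ 9 / 8 * (‖p' - z‖ + ‖z - p‖) * ‖p' - w‖ := by
  have hpZ : p' ∈ Z := hp' ▸ metricProj_mem hc ⟨w, hw⟩ _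
  have h1 := inner_sub_metricProj_nonpos hc hconv (p - η • F z) hw
  rw [← hp'] at h1
  have hF : ‖F p' - F z‖ ≤ L * ‖p' - z‖ := by
    simpa [dist_eq_norm] using hL.dist_le_mul p' hpZ z hzZ
  -- The displacement `p - p'` contributes the factor 1, and evaluating `F` at `z` instead of `p'`
  -- contributes `η * L ≤ 1 / 8`; together they give `9 / 8`.
  have e : η * inner ℝ (F p') (p' - w) = inner ℝ (p - η • F z - p') (w - p')
      + inner ℝ (p - p') (p' - w) + η * inner ℝ (F p' - F z) (p' - w) := by
    simp only [inner_sub_left, inner_sub_right, inner_smul_left, conj_trivial]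
    ring
  have h2 : inner ℝ (p - p') (p' - w) ≤ (‖p' - z‖ + ‖z - p‖) * ‖p' - w‖ := by
    refine (real_inner_le_norm _ _).trans ?_
    gcongr
    rw [norm_sub_rev]
    simpa using norm_add_le (p' - z) (z - p)
  have h3 : η * inner ℝ (F p' - F z) (p' - w) ≤ 1 / 8 * ‖p' - z‖ * ‖p' - w‖ := by
    calc η * inner ℝ (F p' - F z) (p' - w) ≤ η * (‖F p' - F z‖ * ‖p' - w‖) := by
          gcongr; exact real_inner_le_norm _ _
      _ ≤ η * (L * ‖p' - z‖ * ‖p' - w‖) := by gcongr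
      _ = (η * L) * (‖p' - z‖ * ‖p' - w‖) := by ring
      _ ≤ 1 / 8 * (‖p' - z‖ * ‖p' - w‖) := by gcongr
      _ = _ := by ring
  nlinarith [mul_nonneg (norm_nonneg (z - p)) (norm_nonneg (p' - w))]

/-- Linear convergence of the optimistic gradient method for a variational inequality whose gap
grows at least linearly with the distance to the solution set. -/
theorem optimistic_linear_convergence {Z Zs : Set E} (hc : IsCompact Z) (hconv : Convex ℝ Z)
    (hsc : IsCompact Zs) (hsne : Zs.Nonempty) (hsZ : Zs ⊆ Z) {F : E → E}
    {L : ℝ≥0} (hL : LipschitzOnWith L F Z) {η : ℝ} (hη : 0 < η) (hηL : η * L ≤ 1 / 8)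
    (hmono : ∀ z ∈ Z, ∀ w ∈ Zs, 0 ≤ inner ℝ (F z) (z - w))
    {C : ℝ} (hC : 0 < C)
    (hgap : ∀ z ∈ Z, ∃ w ∈ Z, C * ‖z - metricProj Zs z‖ * ‖z - w‖ ≤ inner ℝ (F z) (z - w) ∧
      (w = z → z ∈ Zs))
    (z zh : ℕ → E) (h0 : z 0 = zh 0) (hz0 : z 0 ∈ Z)
    (hz : ∀ t, z (t + 1) = metricProj Z (zh t - η • F (z t)))
    (hzh : ∀ t, zh (t + 1) = metricProj Z (zh t - η • F (z (t + 1)))) (t : ℕ) :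
    distSq (z t) Zs ≤ 64 * distSq (z 0) Zs *
      (1 / (1 + min (16 * η ^ 2 * C ^ 2 / 81) (1 / 2))) ^ t := by
  have hne : Z.Nonempty := ⟨_, hz0⟩
  set c := min (16 * η ^ 2 * C ^ 2 / 81) (1 / 2)
  have hc0 : 0 ≤ c := le_min (by positivity) (by norm_num)
  have hc1 : c ≤ 16 * η ^ 2 * C ^ 2 / 81 := min_le_left _ _
  have hc2 : c ≤ 1 / 2 := min_le_right _ _
  have hzZ : ∀ t, z t ∈ Z := fun t => by
    cases t with
    | zero => exact hz0
    | succ t => rw [hz]; exact metricProj_mem hc hne _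
  have hzhZ : ∀ t, zh t ∈ Z := fun t => by
    cases t with
    | zero => rw [← h0]; exact hz0
    | succ t => rw [hzh]; exact metricProj_mem hc hne _
  have hdist : ∀ p ∈ Z, ∀ ζ : ℝ, 0 ≤ ζ →
      (∀ w ∈ Z, η * inner ℝ (F p) (p - w) ≤ 9 / 8 * ζ * ‖p - w‖) →
      η * C * ‖p - metricProj Zs p‖ ≤ 9 / 8 * ζ := by
    intro p hp ζ hζ h
    obtain ⟨w, hw, hw1, hw2⟩ := hgap p hp
    -- When `w = p` the factor `‖p - w‖` cannot be cancelled; this is what the second clause of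
    -- `hgap` is for.
    by_cases hpw : w = p
    · have := distSq_le hsc p (hw2 hpw)
      have h0 : ‖p - metricProj Zs p‖ = 0 := by
        simpa [distSq] using this
      rw [h0]; simp only [mul_zero]; positivity
    · have hpos : 0 < ‖p - w‖ := norm_pos_iff.2 (sub_ne_zero.2 (Ne.symm hpw))
      refine le_of_mul_le_mul_right ?_ hpos
      have := mul_le_mul_of_nonneg_left hw1 hη.le
      linarith [h w hw]
  have hstep : ∀ t, (1 + c) * (distSq (zh (t + 1)) Zs + 1 / 16 * ‖zh (t + 1) - z (t + 1)‖ ^ 2)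
      ≤ distSq (zh t) Zs + 1 / 16 * ‖zh t - z t‖ ^ 2 := by
    intro t
    have hw := metricProj_mem hsc hsne (zh t)
    have hA := optimistic_step_energy hc hconv hL hη hηL (hzZ t) (hz t) (hzh t) (hsZ hw)
    have hm := mul_nonneg hη.le (hmono _ (hzZ (t + 1)) _ hw)
    have hd := distSq_le hsc (zh (t + 1)) hw
    have hB := hdist _ (hzhZ (t + 1)) (‖zh (t + 1) - z (t + 1)‖ + ‖z (t + 1) - zh t‖)
      (by positivity) (fun w hw => optimistic_step_gap hc hconv hL hη hηL (hzZ (t + 1)) (hzh t) hw)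
    have hD : distSq (zh t) Zs = ‖zh t - metricProj Zs (zh t)‖ ^ 2 := rfl
    have hD' : distSq (zh (t + 1)) Zs = ‖zh (t + 1) - metricProj Zs (zh (t + 1))‖ ^ 2 := rfl
    rw [hD'] at hd ⊢
    rw [hD]
    set d := ‖zh (t + 1) - metricProj Zs (zh (t + 1))‖
    set x := ‖zh (t + 1) - z (t + 1)‖
    set y := ‖z (t + 1) - zh t‖
    have hd0 : 0 ≤ d := norm_nonneg _
    have hsq : (η * C * d) ^ 2 ≤ (9 / 8 * (x + y)) ^ 2 :=
      pow_le_pow_left₀ (by positivity) hB 2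
    -- Origin of the rate: `(9/8)² (x + y)² ≤ (81/32) (x² + y²)`. Half of `x² + y²` pays for `c *
    -- d²`, and the cap `c ≤ 1 / 2` keeps the remaining `c * x² / 16` within the available `15/16`.
    have hsq' : 16 * η ^ 2 * C ^ 2 / 81 * d ^ 2 ≤ 1 / 2 * (x ^ 2 + y ^ 2) := by
      nlinarith [sq_nonneg (x - y)]
    have h1 : c * d ^ 2 ≤ 16 * η ^ 2 * C ^ 2 / 81 * d ^ 2 := by gcongr
    have h2 : c * x ^ 2 ≤ 1 / 2 * x ^ 2 := by gcongr
    nlinarith [sq_nonneg x, sq_nonneg y]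
  have hind : ∀ t, distSq (zh t) Zs + 1 / 16 * ‖zh t - z t‖ ^ 2
      ≤ distSq (z 0) Zs * (1 / (1 + c)) ^ t := by
    intro t
    induction t with
    | zero => simp [h0]
    | succ t ih =>
      have h := (hstep t).trans ih
      rw [pow_succ (1 / (1 + c)) t, ← mul_assoc, mul_one_div, le_div_iff₀ (by positivity)]
      linarith
  have hfin := hind t
  have hw := metricProj_mem hsc hsne (zh t)
  have hd := distSq_le hsc (z t) hw
  have htri : ‖z t - metricProj Zs (zh t)‖ ≤ ‖zh t - z t‖ + ‖zh t - metricProj Zs (zh t)‖ := by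
    rw [norm_sub_rev (zh t) (z t)]
    simpa using norm_add_le (z t - zh t) (zh t - metricProj Zs (zh t))
  have hD : distSq (zh t) Zs = ‖zh t - metricProj Zs (zh t)‖ ^ 2 := rfl
  rw [hD] at hfin
  -- The triangle inequality gives `dist² ≤ 2 ‖zh - z‖² + 2 dist(zh)²`, at most 32 times the energy;
  -- 64 leaves room.
  nlinarith [norm_nonneg (z t - metricProj Zs (zh t)),
    sq_nonneg (‖zh t - z t‖ - ‖zh t - metricProj Zs (zh t)‖),
    sq_nonneg ‖zh t - metricProj Zs (zh t)‖, sq_nonneg ‖zh t - z t‖]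

end Optimistic

/-! ### Hoffman's bound and linear growth of the gap on a polytope. -/

section Polyhedral

variable {E : Type*} [NormedAddCommGroup E] [InnerProductSpace ℝ E]

/-- Compactness step behind Hoffman's bound: the hypothesis puts `d` in the polar of the cone `{y |
∀ f ∈ J, f.linear y ≤ 0}`. If the sum vanished, `d` would also lie in that cone, and `y = d` would
give `‖d‖² ≤ 0`. Hence the sum is positive on the unit sphere of the polar, and homogeneity does the
rest. -/
theorem exists_pos_mul_norm_le_sum_max [FiniteDimensional ℝ E] (J : Finset (E →ᵃ[ℝ] ℝ)) :
    ∃ m : ℝ, 0 < m ∧ ∀ d : E,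
      (∀ y : E, (∀ f ∈ J, f.linear y ≤ 0) → inner ℝ d y ≤ 0) →
      m * ‖d‖ ≤ ∑ f ∈ J, max (f.linear d) 0 := by
  set N : Set E := {d | ∀ y : E, (∀ f ∈ J, f.linear y ≤ 0) → inner ℝ d y ≤ 0} with hN
  have hNc : IsClosed N := by
    simp only [hN, Set.ofPred_forall]
    exact isClosed_iInter fun y => isClosed_iInter fun _ =>
      isClosed_le (by fun_prop) continuous_const
  have hK : IsCompact (Metric.sphere (0 : E) 1 ∩ N) := (isCompact_sphere 0 1).inter_right hNc
  have hcont : Continuous fun d : E => ∑ f ∈ J, max (f.linear d) 0 := by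
    refine continuous_finsetSum _ fun f _ => ?_
    exact (LinearMap.continuous_of_finiteDimensional f.linear).max continuous_const
  obtain ⟨m, hm, hmle⟩ : ∃ m : ℝ, 0 < m ∧ ∀ d ∈ Metric.sphere (0 : E) 1 ∩ N,
      m ≤ ∑ f ∈ J, max (f.linear d) 0 := by
    rcases (Metric.sphere (0 : E) 1 ∩ N).eq_empty_or_nonempty with h | h
    · exact ⟨1, one_pos, by simp [h]⟩
    · obtain ⟨d, hd, hmin⟩ := hK.exists_isMinOn h hcont.continuousOn
      refine ⟨_, ?_, fun d' hd' => hmin hd'⟩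
      by_contra hle
      have h0 : ∑ f ∈ J, max (f.linear d) 0 = 0 :=
        le_antisymm (not_lt.1 hle) (Finset.sum_nonneg fun _ _ => le_max_right _ _)
      rw [Finset.sum_eq_zero_iff_of_nonneg fun _ _ => le_max_right _ _] at h0
      have := hd.2 d fun f hf => max_eq_right_iff.1 (h0 f hf)
      rw [real_inner_self_eq_norm_sq, mem_sphere_zero_iff_norm.1 hd.1] at this
      norm_num at this
  refine ⟨m, hm, fun d hd => ?_⟩
  by_cases h0 : d = 0
  · simp [h0]
  have hpos : 0 < ‖d‖ := norm_pos_iff.2 h0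
  have h := hmle (‖d‖⁻¹ • d) ⟨by simp [norm_smul, hpos.ne'], fun y hy => by
    rw [inner_smul_left]
    exact mul_nonpos_of_nonneg_of_nonpos (by simp) (hd y hy)⟩
  have e : ∑ f ∈ J, max (f.linear (‖d‖⁻¹ • d)) 0 = ‖d‖⁻¹ * ∑ f ∈ J, max (f.linear d) 0 := by
    rw [Finset.mul_sum]
    refine Finset.sum_congr rfl fun f _ => ?_
    rw [map_smul, smul_eq_mul, mul_max_of_nonneg _ _ (by positivity), mul_zero]
  rw [e, inv_mul_eq_div, le_div_iff₀ hpos] at h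
  exact h

/-- Constraints inactive at `p` keep some slack under a small move, and active ones do not increase
along `y`: a direction that respects the active constraints is feasible. -/
theorem exists_pos_forall_affineMap_add_smul_nonpos (T : Finset (E →ᵃ[ℝ] ℝ)) {p y : E}
    (hp : ∀ f ∈ T, f p ≤ 0) (hy : ∀ f ∈ T, f p = 0 → f.linear y ≤ 0) :
    ∃ ε : ℝ, 0 < ε ∧ ∀ f ∈ T, f (p + ε • y) ≤ 0 := by
  have hlin : ∀ f : E →ᵃ[ℝ] ℝ, ∀ ε : ℝ, f (p + ε • y) = f p + ε * f.linear y := fun f ε => by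
    rw [add_comm p, ← vadd_eq_add, f.map_vadd]
    simp [add_comm]
  have : ∀ f ∈ T, ∀ᶠ ε : ℝ in nhdsWithin 0 (Set.Ioi 0), f (p + ε • y) ≤ 0 := by
    intro f hf
    simp only [hlin]
    rcases (hp f hf).lt_or_eq with h | h
    · have hc : Filter.Tendsto (fun ε : ℝ => f p + ε * f.linear y) (nhdsWithin 0 (Set.Ioi 0))
          (nhds (f p + 0 * f.linear y)) :=
        ((by fun_prop : Continuous fun ε : ℝ => f p + ε * f.linear y).tendsto 0).mono_left
          nhdsWithin_le_nhds
      simp only [zero_mul, add_zero] at hc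
      exact (hc.eventually_lt_const h).mono fun _ => le_of_lt
    · filter_upwards [self_mem_nhdsWithin] with ε hε
      rw [h, zero_add]
      exact mul_nonpos_of_nonneg_of_nonpos (le_of_lt hε) (hy f hf h)
  have h2 := (Filter.eventually_all_finset T).2 this
  obtain ⟨ε, h, hε⟩ := (h2.and self_mem_nhdsWithin).exists
  exact ⟨ε, hε, h⟩

/-- Hoffman's error bound for a finite system of affine inequalities. -/
theorem exists_norm_sub_metricProj_le_sum_max [FiniteDimensional ℝ E] (T : Finset (E →ᵃ[ℝ] ℝ)) {P : Set E}
    (hP : P = {x | ∀ f ∈ T, f x ≤ 0}) (hc : IsCompact P) (hne : P.Nonempty) :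
    ∃ K : ℝ, 0 < K ∧ ∀ x, ‖x - metricProj P x‖ ≤ K * ∑ f ∈ T, max (f x) 0 := by
  classical
  -- The active set at the projection varies with `x`, but there are only finitely many subsets of
  -- `T`; summing the reciprocal constants over all of them gives one uniform `K`.
  choose m hm hmle using exists_pos_mul_norm_le_sum_max (E := E)
  refine ⟨∑ J ∈ T.powerset, (m J)⁻¹, Finset.sum_pos (fun J _ => inv_pos.2 (hm J))
    ⟨∅, by simp⟩, fun x => ?_⟩
  obtain ⟨hpP, hmin⟩ := metricProj_mem_and_forall_norm_le hc hne x
  set p := metricProj P x with hpdef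
  have hpT : ∀ f ∈ T, f p ≤ 0 := by rw [hP] at hpP; exact hpP
  set J := T.filter fun f => f p = 0 with hJ
  have hconv : Convex ℝ P := by
    rw [hP, Set.ofPred_forall]
    refine convex_iInter fun f => ?_
    rw [Set.ofPred_forall]
    refine convex_iInter fun _ => ?_
    exact (convex_Iic (0 : ℝ)).affine_preimage f
  -- The residual `x - p` is normal to `P` at `p`, so it has nonpositive inner product with every
  -- direction respecting the active constraints.
  have hN := hmle J (x - p) fun y hy => by
    obtain ⟨ε, hε, hεT⟩ := exists_pos_forall_affineMap_add_smul_nonpos T (p := p) (y := y) hpT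
      fun f hf hfp => hy f (by simp [hJ, hf, hfp])
    have hmem : p + ε • y ∈ P := by rw [hP]; exact hεT
    have h := inner_sub_metricProj_nonpos hc hconv x hmem
    rw [← hpdef, add_sub_cancel_left, inner_smul_right] at h
    exact nonpos_of_mul_nonpos_right h hε
  have hle : ∑ f ∈ J, max (f.linear (x - p)) 0 ≤ ∑ f ∈ T, max (f x) 0 := by
    have : ∑ f ∈ J, max (f.linear (x - p)) 0 = ∑ f ∈ J, max (f x) 0 := by
      refine Finset.sum_congr rfl fun f hf => ?_
      have h0 : f p = 0 := (Finset.mem_filter.1 hf).2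
      have := f.linearMap_vsub x p
      simp only [vsub_eq_sub, h0, sub_zero] at this
      rw [this]
    rw [this]
    exact Finset.sum_le_sum_of_subset_of_nonneg (Finset.filter_subset _ _)
      fun _ _ _ => le_max_right _ _
  have h1 : ‖x - p‖ ≤ (m J)⁻¹ * ∑ f ∈ T, max (f x) 0 := by
    rw [inv_mul_eq_div, le_div_iff₀ (hm J), mul_comm]
    exact hN.trans hle
  refine h1.trans (mul_le_mul_of_nonneg_right ?_ (Finset.sum_nonneg fun _ _ => le_max_right _ _))
  exact Finset.single_le_sum (f := fun J => (m J)⁻¹) (fun J _ => (inv_pos.2 (hm J)).le)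
    (Finset.mem_powerset.2 (Finset.filter_subset _ _))

/-- A set cut out by finitely many affine inequalities. -/
def IsPolyhedral (Z : Set E) : Prop :=
  ∃ T : Finset (E →ᵃ[ℝ] ℝ), Z = {x | ∀ f ∈ T, f x ≤ 0}

theorem IsPolyhedral.convex {Z : Set E} (h : IsPolyhedral Z) : Convex ℝ Z := by
  obtain ⟨T, rfl⟩ := h
  simp only [Set.ofPred_forall]
  exact convex_iInter fun f => convex_iInter fun _ => (convex_Iic (0 : ℝ)).affine_preimage f

/-- An extreme point is determined by its active constraints. If `x` and `x'` share them, `x` can be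
pushed slightly away from `x'` inside `Z`, which places `x` in an open segment with endpoint `x'`.
-/
theorem IsPolyhedral.finite_extremePoints {Z : Set E} (h : IsPolyhedral Z) :
    (Z.extremePoints ℝ).Finite := by
  classical
  obtain ⟨T, hZ⟩ := h
  refine Set.Finite.of_finite_image (f := fun x => T.filter fun f => f x = 0)
    ((T.powerset.finite_toSet).subset ?_) ?_
  · rintro _ ⟨x, _, rfl⟩
    exact Finset.mem_coe.2 (Finset.mem_powerset.2 (Finset.filter_subset _ _))
  · intro x hx x' hx' hxx'
    have hxT : ∀ f ∈ T, f x ≤ 0 := by have := hx.1; rw [hZ] at this; exact this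
    have hlin : ∀ f ∈ T, f x = 0 → f.linear (x' - x) = 0 := fun f hf h0 => by
      have h1 : f ∈ T.filter fun f => f x' = 0 := by
        have : f ∈ T.filter fun f => f x = 0 := Finset.mem_filter.2 ⟨hf, h0⟩
        exact (congrArg (f ∈ ·) hxx').mp this
      have := f.linearMap_vsub x' x
      simpa [h0, (Finset.mem_filter.1 h1).2] using this
    obtain ⟨ε, hε, h1⟩ := exists_pos_forall_affineMap_add_smul_nonpos T (p := x) (y := x - x') hxT
      fun f hf h0 => by rw [← neg_sub, map_neg, hlin f hf h0, neg_zero]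
    have hmem : x + ε • (x - x') ∈ Z := by rw [hZ]; exact h1
    have hseg : x ∈ openSegment ℝ x' (x + ε • (x - x')) := by
      refine ⟨ε / (1 + ε), 1 / (1 + ε), by positivity, by positivity, by field_simp; ring, ?_⟩
      have : (1 + ε) ≠ 0 := by positivity
      match_scalars <;> field_simp
      ring
    exact (hx.2 hx'.1 hmem hseg).symm

/-- Linear growth of a biaffine gap function away from its solution set in a polytope. -/
theorem IsPolyhedral.exists_pos_mul_norm_le_gap [FiniteDimensional ℝ E] {Z : Set E} (hZ : IsPolyhedral Z)
    (hc : IsCompact Z) (G : E → E → ℝ) (hG₀ : ∀ z, G z z = 0)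
    (hG₁ : ∀ w, ∃ f : E →ᵃ[ℝ] ℝ, ∀ z, f z = G z w)
    (hG₂ : ∀ z, ∃ f : E →ᵃ[ℝ] ℝ, ∀ w, f w = G z w) {Zs : Set E}
    (hZs : Zs = {z | z ∈ Z ∧ ∀ w ∈ Z, G z w ≤ 0}) (hne : Zs.Nonempty) :
    IsCompact Zs ∧ ∃ C : ℝ, 0 < C ∧ ∀ z ∈ Z, ∃ w ∈ Z, C * ‖z - metricProj Zs z‖ ≤ G z w := by
  classical
  choose g hg using hG₁
  have hfin := hZ.finite_extremePoints
  have hconv := hZ.convex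
  obtain ⟨T, hT⟩ := hZ
  set V := hfin.toFinset with hV
  -- Krein–Milman: an affine function nonpositive at the extreme points is nonpositive on `Z`.
  have hmax : ∀ z, (∀ v ∈ V, G z v ≤ 0) → ∀ w ∈ Z, G z w ≤ 0 := by
    intro z hz w hw
    obtain ⟨f, hf⟩ := hG₂ z
    have hcont : Continuous f := f.continuous_of_finiteDimensional
    have hsub : closure (convexHull ℝ (Z.extremePoints ℝ)) ⊆ f ⁻¹' Set.Iic 0 := by
      refine closure_minimal (convexHull_min ?_ ((convex_Iic (0 : ℝ)).affine_preimage f))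
        (isClosed_Iic.preimage hcont)
      intro v hv
      rw [Set.mem_preimage, Set.mem_Iic, hf]
      exact hz v (by simpa [hV] using hv)
    rw [closure_convexHull_extremePoints hc hconv] at hsub
    have := hsub hw
    rwa [Set.mem_preimage, Set.mem_Iic, hf] at this
  have hVZ : ∀ v ∈ V, v ∈ Z := fun v hv => by
    have : v ∈ Z.extremePoints ℝ := by simpa [hV] using hv
    exact this.1
  have hZs' : Zs = {x | ∀ f ∈ T ∪ V.image g, f x ≤ 0} := by
    ext z
    simp only [hZs, Finset.mem_union, Finset.mem_image, Set.mem_ofPred_eq]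
    constructor
    · rintro ⟨h1, h2⟩ f (hf | ⟨v, hv, rfl⟩)
      · rw [hT] at h1; exact h1 f hf
      · rw [hg]; exact h2 v (hVZ v hv)
    · intro h
      refine ⟨by rw [hT]; exact fun f hf => h f (Or.inl hf), hmax z fun v hv => ?_⟩
      rw [← hg]
      exact h _ (Or.inr ⟨v, hv, rfl⟩)
  have hcl : IsClosed Zs := by
    rw [hZs']
    simp only [Set.ofPred_forall]
    exact isClosed_iInter fun f => isClosed_iInter fun _ =>
      isClosed_le f.continuous_of_finiteDimensional continuous_const
  have hcs : IsCompact Zs := hc.of_isClosed_subset hcl fun z hz => by rw [hZs] at hz; exact hz.1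
  refine ⟨hcs, ?_⟩
  obtain ⟨K, hK, hbound⟩ := exists_norm_sub_metricProj_le_sum_max _ hZs' hcs hne
  have hVne : V.Nonempty := by
    have hZne : Z.Nonempty := by
      obtain ⟨z, hz⟩ := hne; rw [hZs] at hz; exact ⟨z, hz.1⟩
    simpa [hV] using hc.extremePoints_nonempty hZne
  have hcard : (0 : ℝ) < V.card := by exact_mod_cast hVne.card_pos
  refine ⟨(K * V.card)⁻¹, by positivity, fun z hz => ?_⟩
  by_cases h0 : ‖z - metricProj Zs z‖ = 0
  · exact ⟨z, hz, by rw [h0, hG₀, mul_zero]⟩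
  have hpos : 0 < ‖z - metricProj Zs z‖ := lt_of_le_of_ne (norm_nonneg _) (Ne.symm h0)
  -- For `z ∈ Z` the constraints in `T` contribute nothing to Hoffman's bound, so only the gaps at
  -- the vertices remain.
  have hsum : ∑ f ∈ T ∪ V.image g, max (f z) 0 ≤ ∑ v ∈ V, max (G z v) 0 := by
    have h1 : ∑ f ∈ T, max (f z) 0 = 0 := Finset.sum_eq_zero fun f hf => by
      rw [hT] at hz; exact max_eq_right (hz f hf)
    have h2 : ∑ f ∈ V.image g, max (f z) 0 ≤ ∑ v ∈ V, max (g v z) 0 :=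
      Finset.sum_image_le_of_nonneg (f := fun f : E →ᵃ[ℝ] ℝ => max (f z) 0)
        fun _ _ => le_max_right _ _
    have h3 := Finset.sum_union_inter (s₁ := T) (s₂ := V.image g) (f := fun f => max (f z) 0)
    have h4 : 0 ≤ ∑ f ∈ T ∩ V.image g, max (f z) 0 :=
      Finset.sum_nonneg fun _ _ => le_max_right _ _
    simp only [hg] at h2
    linarith
  obtain ⟨v, hv, hvmax⟩ := V.exists_max_image (fun v => max (G z v) 0) hVne
  have h2 : ∑ v ∈ V, max (G z v) 0 ≤ V.card * max (G z v) 0 := by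
    have := Finset.sum_le_card_nsmul V (fun v => max (G z v) 0) _ hvmax
    simpa using this
  refine ⟨v, hVZ v hv, ?_⟩
  have h3 := (hbound z).trans (mul_le_mul_of_nonneg_left (hsum.trans h2) hK.le)
  have h4 : (K * V.card)⁻¹ * ‖z - metricProj Zs z‖ ≤ max (G z v) 0 := by
    rw [inv_mul_eq_div, div_le_iff₀ (by positivity)]
    linarith
  rcases le_max_iff.1 (le_refl (max (G z v) 0)) with h5 | h5
  · exact h4.trans h5
  · have : 0 < (K * V.card)⁻¹ * ‖z - metricProj Zs z‖ := by positivity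
    linarith

end Polyhedral

/-! ### Closure properties of polyhedral sets. -/

namespace IsPolyhedral

variable {E : Type*} [NormedAddCommGroup E] [InnerProductSpace ℝ E]

theorem isClosed [FiniteDimensional ℝ E] {Z : Set E} (h : IsPolyhedral Z) : IsClosed Z := by
  obtain ⟨T, rfl⟩ := h
  simp only [Set.ofPred_forall]
  exact isClosed_iInter fun f => isClosed_iInter fun _ =>
    isClosed_le f.continuous_of_finiteDimensional continuous_const

theorem halfSpace (f : E →ᵃ[ℝ] ℝ) : IsPolyhedral {x | f x ≤ 0} :=
  ⟨{f}, by simp⟩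

theorem inter {X Y : Set E} (hX : IsPolyhedral X) (hY : IsPolyhedral Y) :
    IsPolyhedral (X ∩ Y) := by
  classical
  obtain ⟨T, rfl⟩ := hX
  obtain ⟨U, rfl⟩ := hY
  refine ⟨T ∪ U, ?_⟩
  ext x
  simp only [Set.mem_inter_iff, Set.mem_ofPred_eq, Finset.mem_union]
  exact ⟨fun h f hf => hf.elim (h.1 f) (h.2 f),
    fun h => ⟨fun f hf => h f (Or.inl hf), fun f hf => h f (Or.inr hf)⟩⟩

theorem iInter {ι : Type*} [Fintype ι] {X : ι → Set E} (hX : ∀ i, IsPolyhedral (X i)) :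
    IsPolyhedral (⋂ i, X i) := by
  classical
  choose T hT using hX
  refine ⟨Finset.univ.biUnion T, ?_⟩
  ext x
  simp only [hT, Set.mem_iInter, Set.mem_ofPred_eq, Finset.mem_biUnion, Finset.mem_univ, true_and]
  exact ⟨fun h f ⟨i, hf⟩ => h i f hf, fun h i f hf => h f ⟨i, hf⟩⟩

end IsPolyhedral

/-! ### The Lagrangian as a biaffine form, and its gradient field. -/

/-- The pairing `⟨f, q⟩ = ∑_(s,a) f(s,a) q(s,a)`. -/
def statePair {S A : Type*} [Fintype S] [Fintype A] (f q : S → A → ℝ) : ℝ :=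
  ∑ s, ∑ a, f s a * q s a

section StatePair

variable {S A : Type*} [Fintype S] [Fintype A]

theorem statePair_add_mul_sub (f q q' : S → A → ℝ) (t : ℝ) :
    statePair f (fun s a => q s a + t * (q s a - q' s a)) =
      statePair f q + t * (statePair f q - statePair f q') := by
  simp only [statePair, Finset.mul_sum, ← Finset.sum_add_distrib, ← Finset.sum_sub_distrib]
  exact Finset.sum_congr rfl fun s _ => Finset.sum_congr rfl fun a _ => by ring

theorem statePair_add_mul_left (f g q : S → A → ℝ) (t : ℝ) :
    statePair (fun s a => f s a + t * g s a) q = statePair f q + t * statePair g q := by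
  simp only [statePair, Finset.mul_sum, ← Finset.sum_add_distrib]
  exact Finset.sum_congr rfl fun s _ => Finset.sum_congr rfl fun a _ => by ring

end StatePair

namespace CMDP

variable {S A : Type*} [Fintype S] [Fintype A] (M : CMDP S A)

/-- The residual `ρ - (E - γ P)ᵀ q` of the Bellman flow equations. -/
def flowResidual (q : S → A → ℝ) (s : S) : ℝ :=
  M.ρ s - (∑ a, q s a - M.γ * ∑ s', ∑ a', M.P s' a' s * q s' a')

/-- The one-step advantage `f - (E - γ P) μ`. -/
def advantage (f : S → A → ℝ) (mu : S → ℝ) (s : S) (a : A) : ℝ :=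
  f s a - mu s + M.γ * ∑ s', M.P s a s' * mu s'

/-- Summation by parts: the transition operator moves from `q` to `mu`. This passes between the form
of the Lagrangian affine in the multipliers and the one affine in `q`. -/
theorem sum_mul_flowResidual (q : S → A → ℝ) (mu : S → ℝ) :
    ∑ s, mu s * M.flowResidual q s =
      ∑ s, M.ρ s * mu s + statePair (M.advantage 0 mu) q := by
  have h1 : ∑ s, mu s * (M.γ * ∑ s', ∑ a', M.P s' a' s * q s' a') =
      ∑ s, ∑ a, (M.γ * ∑ s', M.P s a s' * mu s') * q s a := by
    simp only [Finset.mul_sum, Finset.sum_mul]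
    rw [Finset.sum_comm]
    refine Finset.sum_congr rfl fun s _ => ?_
    rw [Finset.sum_comm]
    exact Finset.sum_congr rfl fun a _ => Finset.sum_congr rfl fun s' _ => by ring
  have h2 : statePair (M.advantage 0 mu) q =
      ∑ s, ∑ a, (M.γ * ∑ s', M.P s a s' * mu s') * q s a - ∑ s, mu s * ∑ a, q s a := by
    rw [statePair, ← Finset.sum_sub_distrib]
    refine Finset.sum_congr rfl fun s _ => ?_
    rw [Finset.mul_sum, ← Finset.sum_sub_distrib]
    refine Finset.sum_congr rfl fun a _ => ?_
    simp only [advantage, Pi.zero_apply]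
    ring
  rw [h2, ← h1]
  simp only [flowResidual, ← Finset.sum_sub_distrib, ← Finset.sum_add_distrib]
  exact Finset.sum_congr rfl fun s _ => by ring

theorem lagrangian_eq_add_flowResidual (q : S → A → ℝ) (lam : ℝ) (mu : S → ℝ) :
    M.lagrangian q lam mu =
      statePair M.r q + lam * statePair M.g q + ∑ s, mu s * M.flowResidual q s := by
  rw [← statePair_add_mul_left]
  rfl

theorem advantage_eq_add (f : S → A → ℝ) (mu : S → ℝ) :
    M.advantage f mu = fun s a => f s a + 1 * M.advantage 0 mu s a := by
  funext s a
  simp only [advantage, Pi.zero_apply]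
  ring

theorem lagrangian_eq_advantage (q : S → A → ℝ) (lam : ℝ) (mu : S → ℝ) :
    M.lagrangian q lam mu =
      statePair (M.advantage (fun s a => M.r s a + lam * M.g s a) mu) q
        + ∑ s, M.ρ s * mu s := by
  rw [lagrangian_eq_add_flowResidual, sum_mul_flowResidual, M.advantage_eq_add (fun s a => M.r s a + lam * M.g s a),
    statePair_add_mul_left, statePair_add_mul_left]
  ring

theorem lagrangian_add_mul_sub_left (q q' : S → A → ℝ) (lam : ℝ) (mu : S → ℝ) (t : ℝ) :
    M.lagrangian (fun s a => q s a + t * (q s a - q' s a)) lam mu =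
      M.lagrangian q lam mu + t * (M.lagrangian q lam mu - M.lagrangian q' lam mu) := by
  simp only [lagrangian_eq_advantage, statePair_add_mul_sub]
  ring

theorem lagrangian_add_mul_sub_right (q : S → A → ℝ) (lam lam' : ℝ) (mu mu' : S → ℝ) (t : ℝ) :
    M.lagrangian q (lam + t * (lam - lam')) (fun s => mu s + t * (mu s - mu' s)) =
      M.lagrangian q lam mu + t * (M.lagrangian q lam mu - M.lagrangian q lam' mu') := by
  have : ∑ s, (mu s + t * (mu s - mu' s)) * M.flowResidual q s =
      ∑ s, mu s * M.flowResidual q s +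
        t * (∑ s, mu s * M.flowResidual q s - ∑ s, mu' s * M.flowResidual q s) := by
    simp only [Finset.mul_sum, ← Finset.sum_add_distrib, ← Finset.sum_sub_distrib]
    exact Finset.sum_congr rfl fun s _ => by ring
  simp only [lagrangian_eq_add_flowResidual, this]
  ring

theorem differentiable_lagrangian :
    Differentiable ℝ fun w : PrimalDual S A => M.lagrangian w.q w.lam w.mu := by
  unfold lagrangian PrimalDual.q PrimalDual.lam PrimalDual.mu
  fun_prop

theorem inner_gradient_lagrangian {z v : PrimalDual S A} {c : ℝ}
    (h : ∀ t : ℝ, M.lagrangian (z + t • v).q (z + t • v).lam (z + t • v).mu =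
      M.lagrangian z.q z.lam z.mu + t * c) :
    inner ℝ (gradient (fun w : PrimalDual S A => M.lagrangian w.q w.lam w.mu) z) v = c := by
  rw [gradient, InnerProductSpace.toDual_symm_apply]
  have h1 := (M.differentiable_lagrangian z).hasFDerivAt.hasLineDerivAt v
  have h2 : HasLineDerivAt ℝ (fun w : PrimalDual S A => M.lagrangian w.q w.lam w.mu) c z v := by
    unfold HasLineDerivAt
    simp only [h]
    simpa using ((hasDerivAt_id (0 : ℝ)).mul_const c).const_add (M.lagrangian z.q z.lam z.mu)
  exact h1.unique h2

/-- Pairing the gradient field with a displacement gives the duality gap. -/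
theorem inner_gradField (z w : PrimalDual S A) :
    inner ℝ (M.gradField z) (z - w) =
      M.lagrangian w.q z.lam z.mu - M.lagrangian z.q w.lam w.mu := by
  set G := gradient (fun w : PrimalDual S A => M.lagrangian w.q w.lam w.mu) z with hG
  set v₁ : PrimalDual S A := WithLp.toLp 2 (Sum.elim (fun x => (z - w) (Sum.inl x)) 0) with hv₁
  set v₂ : PrimalDual S A := WithLp.toLp 2 (Sum.elim 0 (fun y => (z - w) (Sum.inr y))) with hv₂
  -- The sign flip in the primal block is handled by splitting `z - w` into its primal and dual
  -- parts; along each of them `L` is affine.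
  have e : inner ℝ (M.gradField z) (z - w) = -inner ℝ G v₁ + inner ℝ G v₂ := by
    simp only [PiLp.inner_apply, Fintype.sum_sum_type (f := fun i => inner ℝ _ _), gradField, hv₁,
      hv₂, ← hG]
    simp
  have h₁ : inner ℝ G v₁ = M.lagrangian z.q z.lam z.mu - M.lagrangian w.q z.lam z.mu :=
    M.inner_gradient_lagrangian fun t => by
      rw [← lagrangian_add_mul_sub_left]
      congr 1
      · simp [PrimalDual.lam, hv₁]
      · funext s; simp [PrimalDual.mu, hv₁]
  have h₂ : inner ℝ G v₂ = M.lagrangian z.q z.lam z.mu - M.lagrangian z.q w.lam w.mu :=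
    M.inner_gradient_lagrangian fun t => by
      rw [← lagrangian_add_mul_sub_right]
      congr 1
      funext s a; simp [PrimalDual.q, hv₂]
  rw [e, h₁, h₂]
  ring

theorem exists_affineMap_eq (f : S → A → ℝ) (a : ℝ) (b : S → ℝ) (c : ℝ) :
    ∃ φ : PrimalDual S A →ᵃ[ℝ] ℝ, ∀ z : PrimalDual S A,
      φ z = statePair f z.q + a * z.lam + ∑ s, b s * z.mu s + c := by
  refine ⟨(IsLinearMap.mk' (fun z : PrimalDual S A =>
    statePair f z.q + a * z.lam + ∑ s, b s * z.mu s) ⟨fun x y => ?_, fun t x => ?_⟩).toAffineMap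
      + AffineMap.const ℝ _ c, fun z => rfl⟩
  · simp only [statePair, PrimalDual.q, PrimalDual.lam, PrimalDual.mu, PiLp.add_apply, mul_add,
      Finset.sum_add_distrib]
    ring
  · simp only [statePair, PrimalDual.q, PrimalDual.lam, PrimalDual.mu, PiLp.smul_apply,
      smul_eq_mul, mul_add, Finset.mul_sum]
    simp only [mul_left_comm t]

theorem exists_affineMap_gap_left (w : PrimalDual S A) :
    ∃ φ : PrimalDual S A →ᵃ[ℝ] ℝ, ∀ z : PrimalDual S A,
      φ z = M.lagrangian w.q z.lam z.mu - M.lagrangian z.q w.lam w.mu := by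
  obtain ⟨φ, hφ⟩ := exists_affineMap_eq
    -- The shape `0 + (-1) * _` lets `statePair_add_mul_left` apply.
    (fun s a => 0 + (-1) * M.advantage (fun s a => M.r s a + w.lam * M.g s a) w.mu s a)
    (statePair M.g w.q) (M.flowResidual w.q) (statePair M.r w.q - ∑ s, M.ρ s * w.mu s)
  refine ⟨φ, fun z => ?_⟩
  rw [hφ, lagrangian_eq_add_flowResidual, lagrangian_eq_advantage, statePair_add_mul_left]
  simp only [mul_comm (M.flowResidual _ _)]
  simp [statePair]
  ring

theorem exists_affineMap_gap_right (z : PrimalDual S A) :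
    ∃ φ : PrimalDual S A →ᵃ[ℝ] ℝ, ∀ w : PrimalDual S A,
      φ w = M.lagrangian w.q z.lam z.mu - M.lagrangian z.q w.lam w.mu := by
  obtain ⟨φ, hφ⟩ := M.exists_affineMap_gap_left z
  -- The gap is antisymmetric under exchanging `z` and `w`.
  exact ⟨-φ, fun w => by simp [hφ]⟩

/-! ### The domain is a polytope, and the linear rate on it. -/

theorem isPolyhedral_le (i : (S × A) ⊕ (Unit ⊕ S)) (c : ℝ) :
    IsPolyhedral {z : PrimalDual S A | z i ≤ c} := by
  have h := IsPolyhedral.halfSpace (E := PrimalDual S A)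
    ((EuclideanSpace.proj (𝕜 := ℝ) i).toLinearMap.toAffineMap - AffineMap.const ℝ _ c)
  simpa using h

theorem isPolyhedral_ge (i : (S × A) ⊕ (Unit ⊕ S)) (c : ℝ) :
    IsPolyhedral {z : PrimalDual S A | c ≤ z i} := by
  have h := IsPolyhedral.halfSpace (E := PrimalDual S A)
    (AffineMap.const ℝ _ c - (EuclideanSpace.proj (𝕜 := ℝ) i).toLinearMap.toAffineMap)
  simpa using h

theorem isPolyhedral_le_sum (s : S) (c : ℝ) :
    IsPolyhedral {z : PrimalDual S A | c ≤ ∑ a, z.q s a} := by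
  have h := IsPolyhedral.halfSpace (E := PrimalDual S A)
    (AffineMap.const ℝ _ c -
      (∑ a, EuclideanSpace.proj (𝕜 := ℝ) (Sum.inl (s, a) : (S × A) ⊕ (Unit ⊕ S))
        : PrimalDual S A →L[ℝ] ℝ).toLinearMap.toAffineMap)
  simpa [PrimalDual.q] using h

theorem isPolyhedral_domain_Qbox (ξ : ℝ) : IsPolyhedral (M.domain M.Qbox ξ) := by
  have h := ((IsPolyhedral.iInter fun x : S × A =>
    (isPolyhedral_ge (Sum.inl x : (S × A) ⊕ (Unit ⊕ S)) 0).inter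
      (isPolyhedral_le (Sum.inl x) (1 / (1 - M.γ)))).inter
    ((isPolyhedral_ge (Sum.inr (Sum.inl ()) : (S × A) ⊕ (Unit ⊕ S)) 0).inter
      (isPolyhedral_le (Sum.inr (Sum.inl ())) (1 / ((1 - M.γ) * ξ))))).inter
    (IsPolyhedral.iInter fun s : S =>
      (isPolyhedral_ge (Sum.inr (Sum.inr s) : (S × A) ⊕ (Unit ⊕ S))
        (-((1 - M.γ + 1 / ξ) / (1 - M.γ) ^ 2))).inter
      (isPolyhedral_le (Sum.inr (Sum.inr s)) ((1 - M.γ + 1 / ξ) / (1 - M.γ) ^ 2)))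
  convert h using 1
  ext z
  simp only [domain, Qbox, lamSet, muSet, PrimalDual.q, PrimalDual.lam, PrimalDual.mu, abs_le,
    Set.mem_ofPred_eq, Set.mem_inter_iff, Set.mem_iInter, Set.mem_Icc, Prod.forall, and_assoc]

theorem isPolyhedral_domain_QboxMin (ξ : ℝ) : IsPolyhedral (M.domain M.QboxMin ξ) := by
  have h := (M.isPolyhedral_domain_Qbox ξ).inter
    (IsPolyhedral.iInter fun s : S => isPolyhedral_le_sum (A := A) s M.rhoMin)
  convert h using 1
  ext z
  simp only [domain, QboxMin, Set.mem_ofPred_eq, Set.mem_inter_iff, Set.mem_iInter]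
  tauto

theorem isCompact_domain_Qbox (ξ : ℝ) : IsCompact (M.domain M.Qbox ξ) := by
  set B := max (max (1 / (1 - M.γ)) (1 / ((1 - M.γ) * ξ))) ((1 - M.γ + 1 / ξ) / (1 - M.γ) ^ 2)
  have h1 : 1 / (1 - M.γ) ≤ B := (le_max_left _ _).trans (le_max_left _ _)
  have h2 : 1 / ((1 - M.γ) * ξ) ≤ B := (le_max_right _ _).trans (le_max_left _ _)
  have h3 : (1 - M.γ + 1 / ξ) / (1 - M.γ) ^ 2 ≤ B := le_max_right _ _
  have hB : 0 ≤ B := le_trans (by have := M.γ_lt_one; apply div_nonneg <;> linarith) h1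
  have hK : IsCompact ((EuclideanSpace.equiv ((S × A) ⊕ (Unit ⊕ S)) ℝ).toHomeomorph ⁻¹'
      Set.pi Set.univ fun _ => Set.Icc (-B) B) :=
    (Homeomorph.isCompact_preimage _).2 (isCompact_univ_pi fun _ => isCompact_Icc)
  refine hK.of_isClosed_subset (M.isPolyhedral_domain_Qbox ξ).isClosed ?_
  rintro z ⟨hq, hl, hm⟩
  rw [Set.mem_preimage, Set.mem_univ_pi]
  rintro (⟨s, a⟩ | ⟨⟩ | s)
  · exact ⟨(neg_nonpos.2 hB).trans (hq s a).1, (hq s a).2.trans h1⟩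
  · exact ⟨(neg_nonpos.2 hB).trans hl.1, hl.2.trans h2⟩
  · exact abs_le.1 ((hm s).trans h3)

theorem domain_mono {Q Q' : Set (S → A → ℝ)} (h : Q ⊆ Q') (ξ : ℝ) :
    M.domain Q ξ ⊆ M.domain Q' ξ := fun _ hz => ⟨h hz.1, hz.2⟩

/-- The triple with the given components. -/
def mkPrimalDual (q : S → A → ℝ) (lam : ℝ) (mu : S → ℝ) : PrimalDual S A :=
  WithLp.toLp 2 (Sum.elim (fun x => q x.1 x.2) (Sum.elim (fun _ => lam) mu))

/-- Saddle points are the solutions of the variational inequality of the duality gap. -/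
theorem saddleSet_eq (Q : Set (S → A → ℝ)) (ξ : ℝ) :
    M.saddleSet Q ξ = {z | z ∈ M.domain Q ξ ∧ ∀ w ∈ M.domain Q ξ,
      M.lagrangian w.q z.lam z.mu - M.lagrangian z.q w.lam w.mu ≤ 0} := by
  ext z
  constructor
  · rintro ⟨hz, h1, h2⟩
    exact ⟨hz, fun w hw => by linarith [h1 _ hw.1, h2 _ hw.2.1 _ hw.2.2]⟩
  · rintro ⟨hz, h⟩
    refine ⟨hz, fun q' hq' => ?_, fun lam' hl mu' hm => ?_⟩
    · have := h (mkPrimalDual q' z.lam z.mu) ⟨hq', hz.2.1, hz.2.2⟩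
      exact sub_nonpos.1 this
    · have := h (mkPrimalDual z.q lam' mu') ⟨hz.1, hl, hm⟩
      exact sub_nonpos.1 this

theorem opd_linear_convergence {Q : Set (S → A → ℝ)} {ξ : ℝ} (hQ : Q ⊆ M.Qbox)
    (hpoly : IsPolyhedral (M.domain Q ξ)) (hne : (M.saddleSet Q ξ).Nonempty) :
    IsCompact (M.saddleSet Q ξ) ∧ ∃ C : ℝ, 0 < C ∧
      ∀ Lf : ℝ≥0, LipschitzOnWith Lf M.gradField (M.domain Q ξ) →
      ∀ η : ℝ, 0 < η → η < 1 / (8 * (Lf : ℝ)) →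
      ∀ z₁ ∈ M.domain Q ξ, ∀ t : ℕ,
        distSq (M.opd (M.domain Q ξ) η z₁ t) (M.saddleSet Q ξ) ≤
          64 * distSq z₁ (M.saddleSet Q ξ) *
            (1 / (1 + min (16 * η ^ 2 * C ^ 2 / 81) (1 / 2))) ^ t := by
  have hc : IsCompact (M.domain Q ξ) :=
    (M.isCompact_domain_Qbox ξ).of_isClosed_subset hpoly.isClosed (M.domain_mono hQ ξ)
  obtain ⟨hcs, C, hC, hgap⟩ := hpoly.exists_pos_mul_norm_le_gap hc
    (fun z w => M.lagrangian w.q z.lam z.mu - M.lagrangian z.q w.lam w.mu)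
    (fun z => sub_self _) M.exists_affineMap_gap_left M.exists_affineMap_gap_right
    (M.saddleSet_eq Q ξ) hne
  refine ⟨hcs, ?_⟩
  obtain ⟨D, hD⟩ := hc.isBounded.exists_norm_le
  have hDpos : 0 < 2 * D + 1 := by
    obtain ⟨z, hz⟩ := hne
    have := (norm_nonneg z).trans (hD z hz.1)
    linarith
  -- The growth bound lacks the factor `‖z - w‖` wanted by `optimistic_linear_convergence`; `2 * D +
  -- 1` bounds that factor on the domain.
  refine ⟨C / (2 * D + 1), by positivity, fun Lf hL η hη hηL z₁ hz₁ t => ?_⟩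
  -- For `Lf = 0` the bound `1 / (8 * Lf)` is `0` by the convention on division, contradicting `0 <
  -- η`.
  have hLf : (0 : ℝ) < 8 * Lf := by
    by_contra h
    have h0 : (8 * Lf : ℝ) = 0 := le_antisymm (not_lt.1 h) (by positivity)
    rw [h0, div_zero] at hηL
    linarith
  have hηL' : η * Lf ≤ 1 / 8 := by
    rw [lt_div_iff₀ hLf] at hηL
    linarith
  refine optimistic_linear_convergence hc hpoly.convex hcs hne (fun z hz => hz.1) hL hη hηL'
    ?_ (by positivity) ?_ (fun t => (M.opdPair (M.domain Q ξ) η z₁ t).1)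
    (fun t => (M.opdPair (M.domain Q ξ) η z₁ t).2) rfl hz₁ (fun _ => rfl) (fun _ => rfl) t
  · intro z hz w hw
    rw [inner_gradField]
    linarith [hw.2.1 _ hz.1, hw.2.2 _ hz.2.1 _ hz.2.2]
  · intro z hz
    obtain ⟨w, hw, hle⟩ := hgap z hz
    refine ⟨w, hw, ?_, ?_⟩
    · rw [inner_gradField]
      refine le_trans ?_ hle
      have h1 : ‖z - w‖ ≤ 2 * D + 1 := by
        have := norm_sub_le z w
        linarith [hD z hz, hD w hw]
      calc C / (2 * D + 1) * ‖z - metricProj (M.saddleSet Q ξ) z‖ * ‖z - w‖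
          ≤ C / (2 * D + 1) * ‖z - metricProj (M.saddleSet Q ξ) z‖ * (2 * D + 1) := by gcongr
        _ = C * ‖z - metricProj (M.saddleSet Q ξ) z‖ := by field_simp
    · rintro rfl
      simp only [sub_self] at hle
      have h0 : ‖w - metricProj (M.saddleSet Q ξ) w‖ = 0 :=
        le_antisymm (nonpos_of_mul_nonpos_right hle hC) (norm_nonneg _)
      have := metricProj_mem hcs hne w
      rwa [← sub_eq_zero.1 (norm_eq_zero.1 h0)] at this

end CMDP

/-! ### Occupancy measures and values of recovered policies. -/

theorem isPolicy_recoveredPolicy {S A : Type*} [Fintype A] {q : S → A → ℝ} (hq : ∀ s a, 0 ≤ q s a)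
    (hpos : ∀ s, 0 < ∑ a, q s a) : IsPolicy (recoveredPolicy q) := fun s =>
  ⟨fun a => div_nonneg (hq s a) (hpos s).le, by
    simp only [recoveredPolicy, ← Finset.sum_div]
    exact div_self (hpos s).ne'⟩

namespace CMDP

variable {S A : Type*} [Fintype S] [Fintype A] (M : CMDP S A)

theorem one_sub_γ_pos : 0 < 1 - M.γ := sub_pos.2 M.γ_lt_one

theorem nonempty_states {S A : Type*} [Fintype S] [Fintype A] (M : CMDP S A) : Nonempty S := by
  by_contra h
  rw [not_nonempty_iff] at h
  simpa using M.ρ_sum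

theorem Feasible.nonempty_actions {M : CMDP S A} {ξ : ℝ} (h : M.Feasible ξ) : Nonempty A := by
  obtain ⟨π, hπ, -⟩ := h
  obtain ⟨s⟩ := M.nonempty_states
  by_contra h
  rw [not_nonempty_iff] at h
  simpa using (hπ s).2

theorem stateProb_nonneg {π : S → A → ℝ} (hπ : IsPolicy π) (s₀ : S) (t : ℕ) (s : S) :
    0 ≤ M.stateProb π s₀ t s := by
  induction t generalizing s with
  | zero => unfold stateProb; split_ifs <;> norm_num
  | succ t ih =>
    unfold stateProb
    exact Finset.sum_nonneg fun s' _ => Finset.sum_nonneg fun a _ =>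
      mul_nonneg (mul_nonneg (ih s') ((hπ s').1 a)) (M.P_nonneg _ _ _)

theorem sum_sum_mul_policy_mul_P {π : S → A → ℝ} (hπ : IsPolicy π) (e : S → ℝ) :
    ∑ s, ∑ s', ∑ a, e s' * π s' a * M.P s' a s = ∑ s, e s := by
  rw [Finset.sum_comm]
  refine Finset.sum_congr rfl fun s' _ => ?_
  rw [Finset.sum_comm]
  simp only [← Finset.mul_sum, M.P_sum, mul_one, (hπ s').2]

theorem sum_stateProb {π : S → A → ℝ} (hπ : IsPolicy π) (s₀ : S) (t : ℕ) :
    ∑ s, M.stateProb π s₀ t s = 1 := by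
  classical
  induction t with
  | zero => simp [stateProb]
  | succ t ih =>
    simp only [stateProb]
    rw [M.sum_sum_mul_policy_mul_P hπ, ih]

theorem stateProb_le_one {π : S → A → ℝ} (hπ : IsPolicy π) (s₀ : S) (t : ℕ) (s : S) :
    M.stateProb π s₀ t s ≤ 1 := by
  rw [← M.sum_stateProb hπ s₀ t]
  exact Finset.single_le_sum (fun s _ => M.stateProb_nonneg hπ s₀ t s) (Finset.mem_univ s)

/-- The discounted number of visits `∑_t γ^t Pr(s_t = s | π, s_0 = s₀)`. -/
noncomputable def visits (π : S → A → ℝ) (s₀ s : S) : ℝ :=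
  ∑' t : ℕ, M.γ ^ t * M.stateProb π s₀ t s

theorem hasSum_visits {π : S → A → ℝ} (hπ : IsPolicy π) (s₀ s : S) :
    HasSum (fun t : ℕ => M.γ ^ t * M.stateProb π s₀ t s) (M.visits π s₀ s) := by
  refine Summable.hasSum (Summable.of_nonneg_of_le (fun t => mul_nonneg
    (pow_nonneg M.γ_nonneg _) (M.stateProb_nonneg hπ s₀ t s)) (fun t => ?_)
    (summable_geometric_of_lt_one M.γ_nonneg M.γ_lt_one))
  exact mul_le_of_le_one_right (pow_nonneg M.γ_nonneg _) (M.stateProb_le_one hπ s₀ t s)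

theorem value_eq {π : S → A → ℝ} (hπ : IsPolicy π) (f : S → A → ℝ) (s₀ : S) :
    M.value f π s₀ = ∑ s, ∑ a, M.visits π s₀ s * π s a * f s a := by
  refine HasSum.tsum_eq ?_
  simp only [Finset.mul_sum]
  refine hasSum_sum fun s _ => hasSum_sum fun a _ => ?_
  have := ((M.hasSum_visits hπ s₀ s).mul_right (π s a)).mul_right (f s a)
  simpa only [mul_assoc] using this

/-- Split off the term `t = 0` of the series and apply the one-step recursion to the tail. -/
theorem visits_eq [DecidableEq S] {π : S → A → ℝ} (hπ : IsPolicy π) (s₀ s : S) :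
    M.visits π s₀ s = (if s = s₀ then 1 else 0) +
      M.γ * ∑ s', ∑ a, M.visits π s₀ s' * π s' a * M.P s' a s := by
  have h1 : HasSum (fun t : ℕ => M.γ ^ (t + 1) * M.stateProb π s₀ (t + 1) s)
      (M.γ * ∑ s', ∑ a, M.visits π s₀ s' * π s' a * M.P s' a s) := by
    simp only [stateProb, Finset.mul_sum]
    refine hasSum_sum fun s' _ => hasSum_sum fun a _ => ?_
    have := (((M.hasSum_visits hπ s₀ s').mul_right (π s' a)).mul_right (M.P s' a s)).mul_left M.γ
    simpa only [pow_succ', mul_assoc] using this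
  have h2 := (hasSum_nat_add_iff (f := fun t : ℕ => M.γ ^ t * M.stateProb π s₀ t s) 1).1 h1
  rw [(M.hasSum_visits hπ s₀ s).unique h2, Finset.sum_range_one, pow_zero, one_mul, add_comm]
  simp [stateProb]

/-- The discounted occupancy measure of a policy. -/
noncomputable def occupancy (π : S → A → ℝ) (s : S) (a : A) : ℝ :=
  (∑ s₀, M.ρ s₀ * M.visits π s₀ s) * π s a

theorem valueRho_eq_statePair {π : S → A → ℝ} (hπ : IsPolicy π) (f : S → A → ℝ) :
    M.valueRho f π = statePair f (M.occupancy π) := by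
  simp only [valueRho, M.value_eq hπ, statePair, occupancy, Finset.mul_sum, Finset.sum_mul]
  rw [Finset.sum_comm]
  refine Finset.sum_congr rfl fun s _ => ?_
  rw [Finset.sum_comm]
  exact Finset.sum_congr rfl fun a _ => Finset.sum_congr rfl fun s₀ _ => by ring

/-- The polytope of nonnegative solutions of the Bellman flow equations. -/
def flowSet : Set (S → A → ℝ) :=
  {q | (∀ s a, 0 ≤ q s a) ∧ ∀ s, M.flowResidual q s = 0}

theorem occupancy_mem_flowSet {π : S → A → ℝ} (hπ : IsPolicy π) :
    M.occupancy π ∈ M.flowSet := by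
  classical
  refine ⟨fun s a => mul_nonneg (Finset.sum_nonneg fun s₀ _ => mul_nonneg (M.ρ_nonneg s₀)
    (tsum_nonneg fun t => mul_nonneg (pow_nonneg M.γ_nonneg _) (M.stateProb_nonneg hπ s₀ t s)))
    ((hπ s).1 a), fun s => ?_⟩
  have h1 : ∑ a, M.occupancy π s a = ∑ s₀, M.ρ s₀ * M.visits π s₀ s := by
    simp only [occupancy, ← Finset.mul_sum, (hπ s).2, mul_one]
  have h2 : ∑ s', ∑ a', M.P s' a' s * M.occupancy π s' a' =
      ∑ s₀, M.ρ s₀ * ∑ s', ∑ a, M.visits π s₀ s' * π s' a * M.P s' a s := by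
    simp only [occupancy, Finset.mul_sum, Finset.sum_mul]
    symm
    rw [Finset.sum_comm]
    refine Finset.sum_congr rfl fun s' _ => ?_
    rw [Finset.sum_comm]
    exact Finset.sum_congr rfl fun a _ => Finset.sum_congr rfl fun s₀ _ => by ring
  have h3 : ∑ s₀, M.ρ s₀ * M.visits π s₀ s =
      M.ρ s + M.γ * ∑ s₀, M.ρ s₀ * ∑ s', ∑ a, M.visits π s₀ s' * π s' a * M.P s' a s := by
    simp only [M.visits_eq hπ _ s, mul_add, Finset.sum_add_distrib]
    congr 1
    · simp
    · rw [Finset.mul_sum]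
      exact Finset.sum_congr rfl fun _ _ => by ring
  rw [flowResidual, h1, h2, h3]
  ring

/-- Sum the flow equations over `s`: transitions preserve mass, so the total `m` satisfies `m = 1 +
γ m`. -/
theorem sum_sum_of_mem_flowSet {q : S → A → ℝ} (hq : q ∈ M.flowSet) :
    ∑ s, ∑ a, q s a = 1 / (1 - M.γ) := by
  have h := Finset.sum_eq_zero fun s (_ : s ∈ Finset.univ) => hq.2 s
  simp only [flowResidual, Finset.sum_sub_distrib, M.ρ_sum, ← Finset.mul_sum] at h
  have h2 : ∑ s, ∑ s', ∑ a', M.P s' a' s * q s' a' = ∑ s, ∑ a, q s a := by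
    rw [Finset.sum_comm]
    refine Finset.sum_congr rfl fun s' _ => ?_
    rw [Finset.sum_comm]
    simp only [← Finset.sum_mul, M.P_sum, one_mul]
  rw [h2] at h
  rw [eq_div_iff M.one_sub_γ_pos.ne']
  linarith

theorem statePair_le_of_mem_flowSet {f q : S → A → ℝ} (hq : q ∈ M.flowSet) {c : ℝ}
    (hf : ∀ s a, f s a ≤ c) : statePair f q ≤ c * (1 / (1 - M.γ)) := by
  rw [← M.sum_sum_of_mem_flowSet hq, Finset.mul_sum]
  refine Finset.sum_le_sum fun s _ => ?_
  rw [Finset.mul_sum]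
  exact Finset.sum_le_sum fun a _ => mul_le_mul_of_nonneg_right (hf s a) (hq.1 s a)

theorem flowSet_subset_Qbox : M.flowSet ⊆ M.Qbox := by
  intro q hq s a
  refine ⟨hq.1 s a, ?_⟩
  rw [← M.sum_sum_of_mem_flowSet hq]
  exact (Finset.single_le_sum (fun a _ => hq.1 s a) (Finset.mem_univ a)).trans
    (Finset.single_le_sum (f := fun s => ∑ a, q s a)
      (fun s _ => Finset.sum_nonneg fun a _ => hq.1 s a) (Finset.mem_univ s))

/-- The inflow term is nonnegative, so the flow equation gives `∑ a, q s a ≥ ρ s`. The smaller box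
therefore removes no occupancy measure. -/
theorem flowSet_subset_QboxMin : M.flowSet ⊆ M.QboxMin := by
  intro q hq
  refine ⟨M.flowSet_subset_Qbox hq, fun s => (ciInf_le (Set.finite_range _).bddBelow s).trans ?_⟩
  have h := hq.2 s
  have h2 : 0 ≤ M.γ * ∑ s', ∑ a', M.P s' a' s * q s' a' :=
    mul_nonneg M.γ_nonneg (Finset.sum_nonneg fun s' _ => Finset.sum_nonneg fun a' _ =>
      mul_nonneg (M.P_nonneg _ _ _) (hq.1 _ _))
  rw [flowResidual] at h
  linarith

/-- Solutions of the discounted flow recursion are controlled by the source term. -/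
theorem sum_abs_le_of_flow_recursion {π : S → A → ℝ} (hπ : IsPolicy π) {e h : S → ℝ}
    (he : ∀ s, e s = h s + M.γ * ∑ s', ∑ a, e s' * π s' a * M.P s' a s) :
    (1 - M.γ) * ∑ s, |e s| ≤ ∑ s, |h s| := by
  have h1 : ∑ s, |e s| ≤ ∑ s, (|h s| + M.γ * ∑ s', ∑ a, |e s'| * π s' a * M.P s' a s) := by
    refine Finset.sum_le_sum fun s _ => ?_
    rw [he s]
    refine (abs_add_le _ _).trans ?_
    rw [abs_mul, abs_of_nonneg M.γ_nonneg]
    gcongr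
    · exact M.γ_nonneg
    · refine (Finset.abs_sum_le_sum_abs _ _).trans (Finset.sum_le_sum fun s' _ => ?_)
      refine (Finset.abs_sum_le_sum_abs _ _).trans (Finset.sum_le_sum fun a _ => ?_)
      rw [abs_mul, abs_mul, abs_of_nonneg (M.P_nonneg _ _ _), abs_of_nonneg ((hπ s').1 a)]
  rw [Finset.sum_add_distrib, ← Finset.mul_sum, M.sum_sum_mul_policy_mul_P hπ] at h1
  linarith

/-- The value of the recovered policy is approximated by the linear objective, up to the
violation of the flow equations. -/
theorem abs_valueRho_recoveredPolicy_sub_le {q : S → A → ℝ} (hq : ∀ s a, 0 ≤ q s a)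
    (hpos : ∀ s, 0 < ∑ a, q s a) {f : S → A → ℝ} (hf : ∀ s a, |f s a| ≤ 1) :
    |M.valueRho f (recoveredPolicy q) - statePair f q| ≤
      (∑ s, |M.flowResidual q s|) / (1 - M.γ) := by
  set π := recoveredPolicy q with hπdef
  have hπ : IsPolicy π := isPolicy_recoveredPolicy hq hpos
  have hqπ : ∀ s a, q s a = (∑ a, q s a) * π s a := fun s a => by
    rw [hπdef, recoveredPolicy, mul_div_cancel₀ _ (hpos s).ne']
  set D : S → ℝ := fun s => ∑ s₀, M.ρ s₀ * M.visits π s₀ s with hD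
  set d : S → ℝ := fun s => ∑ a, q s a with hd
  have hocc : ∀ s a, M.occupancy π s a = D s * π s a := fun _ _ => rfl
  have hDsum : ∀ s, ∑ a, M.occupancy π s a = D s := fun s => by
    simp only [hocc, ← Finset.mul_sum, (hπ s).2, mul_one]
  -- Both `D` and the marginal `d` of `q` follow the flow recursion of the same policy `π`, the
  -- latter up to the residual; their difference solves the recursion with the residual as source.
  have hrec := M.sum_abs_le_of_flow_recursion hπ (e := fun s => D s - d s)
    (h := M.flowResidual q) fun s => by
      have h1 := (M.occupancy_mem_flowSet hπ).2 s
      rw [flowResidual, hDsum] at h1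
      have h2 : ∑ s', ∑ a, (D s' - d s') * π s' a * M.P s' a s =
          ∑ s', ∑ a', M.P s' a' s * M.occupancy π s' a' - ∑ s', ∑ a', M.P s' a' s * q s' a' := by
        simp only [← Finset.sum_sub_distrib]
        refine Finset.sum_congr rfl fun s' _ => Finset.sum_congr rfl fun a _ => ?_
        rw [hocc, hqπ s' a]
        ring
      rw [h2, flowResidual]
      linarith
  rw [M.valueRho_eq_statePair hπ, le_div_iff₀ M.one_sub_γ_pos, mul_comm]
  refine le_trans (mul_le_mul_of_nonneg_left ?_ M.one_sub_γ_pos.le) hrec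
  have h3 : statePair f (M.occupancy π) - statePair f q =
      ∑ s, (D s - d s) * ∑ a, π s a * f s a := by
    simp only [statePair, ← Finset.sum_sub_distrib, Finset.mul_sum]
    refine Finset.sum_congr rfl fun s' _ => Finset.sum_congr rfl fun a _ => ?_
    rw [hocc, hqπ s' a]
    ring
  rw [h3]
  refine (Finset.abs_sum_le_sum_abs _ _).trans (Finset.sum_le_sum fun s _ => ?_)
  rw [abs_mul]
  refine mul_le_of_le_one_right (abs_nonneg _) ?_
  rw [← (hπ s).2]
  refine (Finset.abs_sum_le_sum_abs _ _).trans (Finset.sum_le_sum fun a _ => ?_)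
  rw [abs_mul, abs_of_nonneg ((hπ s).1 a)]
  exact mul_le_of_le_one_right ((hπ s).1 a) (hf s a)

theorem flowResidual_sub (q q' : S → A → ℝ) (s : S) :
    M.flowResidual q s - M.flowResidual q' s =
      M.γ * ∑ s', ∑ a', M.P s' a' s * (q s' a' - q' s' a') - ∑ a, (q s a - q' s a) := by
  simp only [flowResidual, mul_sub, Finset.sum_sub_distrib]
  ring

/-- Each entry of `q - q'` counts once through the outflow and, since transition rows sum to 1, at
most `γ ≤ 1` times through the inflow. -/
theorem sum_abs_flowResidual_sub_le (q q' : S → A → ℝ) :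
    ∑ s, |M.flowResidual q s - M.flowResidual q' s| ≤ 2 * ∑ s, ∑ a, |q s a - q' s a| := by
  have h2 : ∑ s, ∑ s', ∑ a', M.P s' a' s * |q s' a' - q' s' a'| = ∑ s, ∑ a, |q s a - q' s a| := by
    rw [Finset.sum_comm]
    refine Finset.sum_congr rfl fun s' _ => ?_
    rw [Finset.sum_comm]
    simp only [← Finset.sum_mul, M.P_sum, one_mul]
  have h1 : ∑ s, |M.flowResidual q s - M.flowResidual q' s| ≤
      ∑ s, (∑ s', ∑ a', M.P s' a' s * |q s' a' - q' s' a'| + ∑ a, |q s a - q' s a|) := by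
    refine Finset.sum_le_sum fun s _ => ?_
    rw [flowResidual_sub]
    refine (abs_sub _ _).trans (add_le_add ?_ (Finset.abs_sum_le_sum_abs _ _))
    rw [abs_mul, abs_of_nonneg M.γ_nonneg]
    refine (mul_le_of_le_one_left (abs_nonneg _) M.γ_lt_one.le).trans ?_
    refine (Finset.abs_sum_le_sum_abs _ _).trans (Finset.sum_le_sum fun s' _ => ?_)
    refine (Finset.abs_sum_le_sum_abs _ _).trans (Finset.sum_le_sum fun a _ => ?_)
    rw [abs_mul, abs_of_nonneg (M.P_nonneg _ _ _)]
  rw [Finset.sum_add_distrib, h2] at h1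
  linarith

theorem abs_g_le_one (s : S) (a : A) : |M.g s a| ≤ 1 := by
  have h1 : 0 ≤ (1 - M.γ) * M.b := mul_nonneg M.one_sub_γ_pos.le M.b_pos.le
  have h2 : (1 - M.γ) * M.b ≤ 1 := by
    have := M.b_le
    rw [le_div_iff₀ M.one_sub_γ_pos] at this
    linarith
  have h3 := M.u_mem s a
  rw [g, abs_le]
  constructor <;> linarith [h3.1, h3.2]

theorem valueRho_g {π : S → A → ℝ} (hπ : IsPolicy π) :
    M.valueRho M.g π = M.valueRho M.u π - M.b := by
  rw [M.valueRho_eq_statePair hπ, M.valueRho_eq_statePair hπ]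
  have h : M.g = fun s a => M.u s a + (-((1 - M.γ) * M.b)) * (fun _ _ => (1 : ℝ)) s a := by
    funext s a
    simp only [g]
    ring
  have h2 : statePair (fun _ _ => (1 : ℝ)) (M.occupancy π) = 1 / (1 - M.γ) := by
    rw [← M.sum_sum_of_mem_flowSet (M.occupancy_mem_flowSet hπ)]
    simp [statePair]
  rw [h, statePair_add_mul_left, h2]
  have := M.one_sub_γ_pos.ne'
  field_simp
  ring

end CMDP

/-! ### Bellman optimality and strong duality. -/

namespace CMDP

variable {S A : Type*} [Fintype S] [Fintype A] (M : CMDP S A)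

theorem abs_sum_P_mul_le (s : S) (a : A) (v : S → ℝ) : |∑ s', M.P s a s' * v s'| ≤ ‖v‖ := by
  refine (Finset.abs_sum_le_sum_abs _ _).trans ?_
  calc ∑ s', |M.P s a s' * v s'| ≤ ∑ s', M.P s a s' * ‖v‖ := by
        refine Finset.sum_le_sum fun s' _ => ?_
        rw [abs_mul, abs_of_nonneg (M.P_nonneg _ _ _)]
        exact mul_le_mul_of_nonneg_left (norm_le_pi_norm v s') (M.P_nonneg _ _ _)
    _ = ‖v‖ := by rw [← Finset.sum_mul, M.P_sum, one_mul]

/-- The Bellman optimality equation has a bounded solution. -/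
theorem exists_bellman_optimal [Nonempty A] (f : S → A → ℝ) {B : ℝ} (hB : 0 ≤ B)
    (hf : ∀ s a, |f s a| ≤ B) :
    ∃ V : S → ℝ, (∀ s a, M.advantage f V s a ≤ 0) ∧ (∀ s, ∃ a, M.advantage f V s a = 0) ∧
      ∀ s, |V s| ≤ B / (1 - M.γ) := by
  -- The Bellman optimality operator is a `γ`-contraction in the sup norm; `V` is its Banach fixed
  -- point.
  set T : (S → ℝ) → S → ℝ := fun V s =>
    Finset.univ.sup' Finset.univ_nonempty fun a => f s a + M.γ * ∑ s', M.P s a s' * V s' with hT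
  have hle : ∀ V s a, f s a + M.γ * ∑ s', M.P s a s' * V s' ≤ T V s := fun V s a =>
    Finset.le_sup' (fun a => f s a + M.γ * ∑ s', M.P s a s' * V s') (Finset.mem_univ a)
  have hlip1 : ∀ V W s, T V s ≤ T W s + M.γ * ‖V - W‖ := by
    intro V W s
    refine Finset.sup'_le _ _ fun a _ => ?_
    have h1 := hle W s a
    have h2 := (le_abs_self _).trans (M.abs_sum_P_mul_le s a (V - W))
    have h3 := mul_le_mul_of_nonneg_left h2 M.γ_nonneg
    simp only [Pi.sub_apply, mul_sub, Finset.sum_sub_distrib] at h3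
    linarith
  have hlip : LipschitzWith ⟨M.γ, M.γ_nonneg⟩ T := by
    refine LipschitzWith.of_dist_le_mul fun V W => ?_
    have h0 : 0 ≤ M.γ * dist V W := mul_nonneg M.γ_nonneg dist_nonneg
    refine (dist_pi_le_iff h0).2 fun s => ?_
    rw [Real.dist_eq, abs_sub_le_iff, dist_eq_norm]
    have h1 := hlip1 V W s
    have h2 := hlip1 W V s
    rw [norm_sub_rev W V] at h2
    constructor <;> linarith
  have hcon : ContractingWith ⟨M.γ, M.γ_nonneg⟩ T := ⟨by exact_mod_cast M.γ_lt_one, hlip⟩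
  set V := ContractingWith.fixedPoint T hcon with hV
  have hfix : T V = V := hcon.fixedPoint_isFixedPt
  have hex : ∀ s, ∃ a, M.advantage f V s a = 0 := by
    intro s
    obtain ⟨a, _, ha⟩ := Finset.exists_mem_eq_sup' (Finset.univ_nonempty (α := A))
      fun a => f s a + M.γ * ∑ s', M.P s a s' * V s'
    refine ⟨a, ?_⟩
    have : V s = f s a + M.γ * ∑ s', M.P s a s' * V s' := by
      rw [← ha]; exact (congrFun hfix s).symm
    rw [advantage]
    linarith
  have hbd : ‖V‖ ≤ B + M.γ * ‖V‖ := by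
    have h0 : 0 ≤ B + M.γ * ‖V‖ := add_nonneg hB (mul_nonneg M.γ_nonneg (norm_nonneg _))
    refine (pi_norm_le_iff_of_nonneg h0).2 fun s => ?_
    obtain ⟨a, ha⟩ := hex s
    have : V s = f s a + M.γ * ∑ s', M.P s a s' * V s' := by rw [advantage] at ha; linarith
    rw [Real.norm_eq_abs, this]
    refine (abs_add_le _ _).trans (add_le_add (hf s a) ?_)
    rw [abs_mul, abs_of_nonneg M.γ_nonneg]
    exact mul_le_mul_of_nonneg_left (M.abs_sum_P_mul_le s a V) M.γ_nonneg
  refine ⟨V, fun s a => ?_, hex, fun s => ?_⟩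
  · have := hle V s a
    rw [hfix] at this
    rw [advantage]
    linarith
  · rw [le_div_iff₀ M.one_sub_γ_pos]
    have := norm_le_pi_norm V s
    rw [Real.norm_eq_abs] at this
    nlinarith [mul_le_mul_of_nonneg_right this M.one_sub_γ_pos.le]

/-- The flow equations annihilate every multiplier `mu`, so replacing `f` by its advantage changes
the objective only by a constant. -/
theorem statePair_advantage_of_mem_flowSet {q : S → A → ℝ} (hq : q ∈ M.flowSet) (f : S → A → ℝ)
    (mu : S → ℝ) : statePair (M.advantage f mu) q + ∑ s, M.ρ s * mu s = statePair f q := by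
  have h := M.sum_mul_flowResidual q mu
  simp only [hq.2, mul_zero, Finset.sum_const_zero] at h
  rw [advantage_eq_add, statePair_add_mul_left]
  linarith

theorem statePair_nonpos {f q : S → A → ℝ} (hf : ∀ s a, f s a ≤ 0) (hq : ∀ s a, 0 ≤ q s a) :
    statePair f q ≤ 0 :=
  Finset.sum_nonpos fun s _ => Finset.sum_nonpos fun a _ =>
    mul_nonpos_of_nonpos_of_nonneg (hf s a) (hq s a)

/-- A solution of the Bellman optimality equation computes the optimal linear objective. -/
theorem exists_mem_flowSet_statePair_eq {f : S → A → ℝ} {V : S → ℝ}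
    (hV : ∀ s, ∃ a, M.advantage f V s a = 0) :
    ∃ q ∈ M.flowSet, statePair f q = ∑ s, M.ρ s * V s := by
  classical
  -- The greedy deterministic policy: its occupancy lives where the advantage vanishes.
  choose α hα using hV
  have hπ : IsPolicy fun s a => if a = α s then (1 : ℝ) else 0 := fun s =>
    ⟨fun a => by dsimp only; split_ifs <;> norm_num, by simp⟩
  have hocc := M.occupancy_mem_flowSet hπ
  refine ⟨_, hocc, ?_⟩
  rw [← M.statePair_advantage_of_mem_flowSet hocc f V, add_eq_right]
  refine Finset.sum_eq_zero fun s _ => Finset.sum_eq_zero fun a _ => ?_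
  by_cases h : a = α s
  · rw [h, hα, zero_mul]
  · simp [occupancy, h]

theorem continuous_statePair (f : S → A → ℝ) : Continuous (statePair f) := by
  unfold statePair
  fun_prop

theorem isCompact_flowSet : IsCompact M.flowSet := by
  have hK : IsCompact (Set.pi Set.univ fun _ : S => Set.pi Set.univ fun _ : A =>
      Set.Icc (0 : ℝ) (1 / (1 - M.γ))) :=
    isCompact_univ_pi fun _ => isCompact_univ_pi fun _ => isCompact_Icc
  refine hK.of_isClosed_subset ?_ fun q hq s _ a _ => M.flowSet_subset_Qbox hq s a
  have : M.flowSet = (⋂ s, ⋂ a, {q | 0 ≤ q s a}) ∩ ⋂ s, {q | M.flowResidual q s = 0} := by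
    ext q
    simp [flowSet]
  rw [this]
  refine (isClosed_iInter fun s => isClosed_iInter fun a =>
    isClosed_le continuous_const (by fun_prop)).inter
    (isClosed_iInter fun s => isClosed_eq ?_ continuous_const)
  unfold flowResidual
  fun_prop

theorem statePair_add_smul (f q q' : S → A → ℝ) (c d : ℝ) :
    statePair f (c • q + d • q') = c * statePair f q + d * statePair f q' := by
  simp only [statePair, Finset.mul_sum, ← Finset.sum_add_distrib, Pi.add_apply, Pi.smul_apply,
    smul_eq_mul]
  exact Finset.sum_congr rfl fun s _ => Finset.sum_congr rfl fun a _ => by ring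

theorem convex_flowSet : Convex ℝ M.flowSet := by
  intro q hq q' hq' c d hc hd hcd
  refine ⟨fun s a => add_nonneg (mul_nonneg hc (hq.1 s a)) (mul_nonneg hd (hq'.1 s a)),
    fun s => ?_⟩
  have h : M.flowResidual (c • q + d • q') s =
      c * M.flowResidual q s + d * M.flowResidual q' s + (1 - (c + d)) * M.ρ s := by
    simp only [flowResidual, Pi.add_apply, Pi.smul_apply, smul_eq_mul, mul_add,
      Finset.sum_add_distrib, mul_left_comm (M.P _ _ _), ← Finset.mul_sum]
    ring
  rw [h, hq.2, hq'.2, hcd]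
  ring

/-- Strong duality in the utility constraint, with a multiplier strictly below the bound. -/
theorem exists_saddle_utility {ξ : ℝ} (hξ : 0 < ξ) (hfeas : M.Feasible ξ) :
    ∃ q ∈ M.flowSet, ∃ lam : ℝ, 0 ≤ lam ∧ lam < 1 / ((1 - M.γ) * ξ) ∧
      0 ≤ statePair M.g q ∧ lam * statePair M.g q = 0 ∧
      ∀ q' ∈ M.flowSet, statePair M.r q' + lam * statePair M.g q' ≤ statePair M.r q := by
  obtain ⟨π, hπ, hπξ⟩ := hfeas
  rw [M.valueRho_eq_statePair hπ] at hπξ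
  have hocc := M.occupancy_mem_flowSet hπ
  have hγ := M.one_sub_γ_pos
  set Λ := 1 / ((1 - M.γ) * ξ) with hΛ
  have hΛpos : 0 < Λ := by positivity
  -- The interval extends beyond `Λ` on purpose: `Λ + 1` stays above the multiplier found, and
  -- comparing with it yields `0 ≤ statePair M.g q`.
  obtain ⟨lam, hlam, q, hq, hsad⟩ := Sion.exists_isSaddlePointOn
    (X := Set.Icc (0 : ℝ) (Λ + 1)) (Y := M.flowSet)
    (f := fun lam q => statePair M.r q + lam * statePair M.g q)
    ⟨0, by constructor <;> linarith⟩ (convex_Icc _ _) isCompact_Icc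
    (fun q _ => by
      refine ContinuousOn.lowerSemicontinuousOn ?_
      fun_prop)
    (fun q _ => by
      refine ConvexOn.quasiconvexOn ⟨convex_Icc _ _, fun x _ y _ c d _ _ hcd => le_of_eq ?_⟩
      simp only [smul_eq_mul]
      linear_combination (-statePair M.r q) * hcd)
    M.convex_flowSet ⟨_, hocc⟩ M.isCompact_flowSet
    (fun lam _ => by
      exact ((continuous_statePair _).add
        (continuous_const.mul (continuous_statePair _))).continuousOn.upperSemicontinuousOn)
    (fun lam _ => by
      refine ConcaveOn.quasiconcaveOn ⟨M.convex_flowSet, fun x _ y _ c d _ _ hcd => le_of_eq ?_⟩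
      simp only [statePair_add_smul, smul_eq_mul]
      ring)
  have hr0 : 0 ≤ statePair M.r (M.occupancy π) := Finset.sum_nonneg fun s _ =>
    Finset.sum_nonneg fun a _ => mul_nonneg (M.r_mem s a).1 (hocc.1 s a)
  have hr1 : ∀ q ∈ M.flowSet, statePair M.r q ≤ 1 / (1 - M.γ) := fun q hq => by
    simpa using M.statePair_le_of_mem_flowSet hq (c := 1) fun s a => (M.r_mem s a).2
  have hmax := fun x hx y hy => hsad x hx y hy
  have h0 := hmax 0 ⟨le_rfl, by linarith⟩ q hq
  have h1 := hmax 0 ⟨le_rfl, by linarith⟩ _ hocc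
  simp only [zero_mul, add_zero] at h0 h1
  have hle : lam * ξ ≤ 1 / (1 - M.γ) - statePair M.r (M.occupancy π) := by
    nlinarith [hr1 q hq, mul_le_mul_of_nonneg_left hπξ hlam.1]
  have hlamΛ : lam ≤ Λ := by
    rw [hΛ, le_div_iff₀ (by positivity)]
    have : lam * ξ ≤ 1 / (1 - M.γ) := by linarith
    rw [le_div_iff₀ hγ] at this
    linarith
  have h2 := hmax (Λ + 1) ⟨by linarith, le_rfl⟩ q hq
  have hg : 0 ≤ statePair M.g q := by
    by_contra hneg
    push Not at hneg
    nlinarith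
  have hcs : lam * statePair M.g q = 0 :=
    le_antisymm (by linarith) (mul_nonneg hlam.1 hg)
  have hopt : ∀ q' ∈ M.flowSet, statePair M.r q' + lam * statePair M.g q' ≤ statePair M.r q :=
    fun q' hq' => by simpa using hmax 0 ⟨le_rfl, by linarith⟩ q' hq'
  rcases hlamΛ.lt_or_eq with hlt | heq
  · exact ⟨q, hq, lam, hlam.1, hlt, hg, hcs, hopt⟩
  -- If `lam = Λ`, comparison with the strictly feasible policy gives `q` reward at least `1 / (1 -
  -- γ)`, the largest possible. So `q` is optimal without the constraint, and the multiplier 0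
  -- serves.
  · refine ⟨q, hq, 0, le_rfl, hΛpos, hg, zero_mul _, fun q' hq' => ?_⟩
    have e : lam * ξ = 1 / (1 - M.γ) := by
      rw [heq, hΛ]
      field_simp
    have := hr1 q' hq'
    have h3 := hopt _ hocc
    nlinarith [mul_le_mul_of_nonneg_left hπξ hlam.1]

/-- An optimal primal-dual triple of the occupancy-measure linear program whose multipliers lie
strictly inside the dual domain. -/
theorem exists_optimal_triple {ξ : ℝ} (hξ : 0 < ξ) (hfeas : M.Feasible ξ) :
    ∃ q ∈ M.flowSet, ∃ (lam : ℝ) (mu : S → ℝ), 0 ≤ lam ∧ lam < 1 / ((1 - M.γ) * ξ) ∧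
      (∀ s, |mu s| < (1 - M.γ + 1 / ξ) / (1 - M.γ) ^ 2) ∧
      0 ≤ statePair M.g q ∧ lam * statePair M.g q = 0 ∧
      (∀ s a, M.advantage (fun s a => M.r s a + lam * M.g s a) mu s a ≤ 0) ∧
      ∑ s, M.ρ s * mu s = statePair M.r q := by
  obtain ⟨q, hq, lam, hlam0, hlam1, hg, hcs, hopt⟩ := M.exists_saddle_utility hξ hfeas
  have hA := hfeas.nonempty_actions
  have hγ := M.one_sub_γ_pos
  obtain ⟨V, hV1, hV2, hV3⟩ := M.exists_bellman_optimal (fun s a => M.r s a + lam * M.g s a)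
    (B := 1 + lam) (by linarith) fun s a => by
      refine (abs_add_le _ _).trans (add_le_add ?_ ?_)
      · rw [abs_of_nonneg (M.r_mem s a).1]
        exact (M.r_mem s a).2
      · rw [abs_mul, abs_of_nonneg hlam0]
        exact mul_le_of_le_one_right hlam0 (M.abs_g_le_one s a)
  refine ⟨q, hq, lam, V, hlam0, hlam1, fun s => (hV3 s).trans_lt ?_, hg, hcs, hV1, ?_⟩
  · have e : (1 - M.γ + 1 / ξ) / (1 - M.γ) ^ 2 = (1 + 1 / ((1 - M.γ) * ξ)) / (1 - M.γ) := by
      field_simp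
    rw [e]
    gcongr
  -- Greedy occupancy gives `∑ s, M.ρ s * V s ≤ statePair M.r q`; nonpositive advantage with
  -- complementary slackness gives the reverse.
  · obtain ⟨q', hq', he⟩ := M.exists_mem_flowSet_statePair_eq hV2
    have h1 := hopt q' hq'
    rw [statePair_add_mul_left] at he
    have h2 := M.statePair_advantage_of_mem_flowSet hq (fun s a => M.r s a + lam * M.g s a) V
    have h3 := statePair_nonpos hV1 hq.1
    rw [statePair_add_mul_left, hcs] at h2
    linarith

end CMDP

/-! ### Iteration count. -/

/-- A number of iterations quadratic in `log (1 / ε)` and `1 / η` suffices for a linear rate. -/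
theorem exists_iteration_bound {C H W : ℝ} (hC : 0 < C) (hH : 0 < H) (hW : 0 < W) :
    ∃ K : ℝ, 0 < K ∧ ∀ η : ℝ, 0 < η → η ≤ H → ∀ ε : ℝ, 0 < ε → ε ≤ 1 / 2 → ∀ t : ℕ,
      K / η ^ 2 * Real.log (1 / ε) ^ 2 ≤ (t : ℝ) →
        W * (1 / (1 + min (16 * η ^ 2 * C ^ 2 / 81) (1 / 2))) ^ t ≤ ε ^ 2 := by
  set c₁ := min (16 * C ^ 2 / 81) (1 / (2 * H ^ 2)) with hc₁
  have hc₁pos : 0 < c₁ := lt_min (by positivity) (by positivity)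
  set W' := max W 1 with hW'
  have hW'1 : 1 ≤ W' := le_max_right _ _
  have hlogW : 0 ≤ Real.log W' := Real.log_nonneg hW'1
  refine ⟨2 * (4 * Real.log W' + 4) / c₁, by positivity, fun η hη hηH ε hε hε2 t ht => ?_⟩
  set c := min (16 * η ^ 2 * C ^ 2 / 81) (1 / 2) with hc
  have hcpos : 0 < c := lt_min (by positivity) (by norm_num)
  have hc2 : c ≤ 1 / 2 := min_le_right _ _
  -- The bound `η ≤ H` turns the cap `1 / 2` into a multiple of `η ^ 2`.
  have hcc : c₁ * η ^ 2 ≤ c := by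
    refine le_min ?_ ?_
    · calc c₁ * η ^ 2 ≤ 16 * C ^ 2 / 81 * η ^ 2 := by gcongr; exact min_le_left _ _
        _ = _ := by ring
    · calc c₁ * η ^ 2 ≤ 1 / (2 * H ^ 2) * H ^ 2 := by gcongr; exact min_le_right _ _
        _ = 1 / 2 := by field_simp
  have hlog : c / 2 ≤ Real.log (1 + c) := by
    refine le_trans ?_ (Real.one_sub_inv_le_log_of_pos (by linarith))
    have : (1 + c)⁻¹ ≤ 1 - c / 2 := by
      rw [inv_le_iff_one_le_mul₀ (by linarith)]
      nlinarith
    linarith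
  set l := Real.log (1 / ε) with hl
  have hl2 : 1 / 2 ≤ l := by
    have h1 : Real.log 2 ≤ l := Real.log_le_log (by norm_num) (by
      rw [le_div_iff₀ hε]; linarith)
    linarith [Real.log_two_gt_d9]
  -- A multiple of `l` plus a constant would suffice; `l ≥ 1 / 2` lets `l ^ 2` dominate both.
  have hmain : Real.log W' + 2 * l ≤ t * Real.log (1 + c) := by
    calc Real.log W' + 2 * l ≤ (4 * Real.log W' + 4) * l ^ 2 := by
          have : 1 ≤ 4 * l ^ 2 := by nlinarith
          nlinarith [mul_le_mul_of_nonneg_left this hlogW]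
      _ = 2 * (4 * Real.log W' + 4) / c₁ / η ^ 2 * l ^ 2 * (c₁ * η ^ 2 / 2) := by field_simp
      _ ≤ t * (c / 2) := by gcongr
      _ ≤ t * Real.log (1 + c) := by gcongr
  have hpow : W' * (1 / ε) ^ 2 ≤ (1 + c) ^ t := by
    rw [← Real.log_le_log_iff (by positivity) (by positivity), Real.log_mul (by positivity)
      (by positivity), Real.log_pow, Real.log_pow]
    exact_mod_cast hmain
  rw [one_div_pow, mul_one_div, div_le_iff₀ (by positivity)]
  calc W ≤ W' := le_max_left _ _
    _ = ε ^ 2 * (W' * (1 / ε) ^ 2) := by field_simp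
    _ ≤ ε ^ 2 * (1 + c) ^ t := by gcongr

/-! ### Structure of the saddle set and ingredients of the corollary. -/

namespace CMDP

variable {S A : Type*} [Fintype S] [Fintype A] (M : CMDP S A)

theorem lagrangian_of_mem_flowSet {q : S → A → ℝ} (hq : q ∈ M.flowSet) (lam : ℝ) (mu : S → ℝ) :
    M.lagrangian q lam mu = statePair M.r q + lam * statePair M.g q := by
  simp [lagrangian_eq_add_flowResidual, hq.2]

/-- Weak duality: a nonpositive advantage is dual feasibility, and the term paired with `q` can be
dropped. -/
theorem lagrangian_le {q : S → A → ℝ} (hq : ∀ s a, 0 ≤ q s a) {lam : ℝ} {mu : S → ℝ}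
    (h : ∀ s a, M.advantage (fun s a => M.r s a + lam * M.g s a) mu s a ≤ 0) :
    M.lagrangian q lam mu ≤ ∑ s, M.ρ s * mu s := by
  rw [lagrangian_eq_advantage]
  linarith [statePair_nonpos h hq]

/-- The optimal triple is a saddle point. Weak duality bounds the Lagrangian over `q'`; on the flow
polytope `mu'` drops out, and `lam' * statePair M.g q ≥ 0` is minimal by complementary slackness. -/
theorem saddleSet_nonempty {ξ : ℝ} (hξ : 0 < ξ) (hfeas : M.Feasible ξ) {Q : Set (S → A → ℝ)}
    (hQ : Q ⊆ M.Qbox) (hQ' : M.flowSet ⊆ Q) : (M.saddleSet Q ξ).Nonempty := by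
  obtain ⟨q, hq, lam, mu, hl0, hl1, hmu, hg, hcs, hadv, hval⟩ := M.exists_optimal_triple hξ hfeas
  have hL : M.lagrangian q lam mu = statePair M.r q := by
    rw [M.lagrangian_of_mem_flowSet hq, hcs, add_zero]
  refine ⟨mkPrimalDual q lam mu, ⟨hQ' hq, ⟨hl0, hl1.le⟩, fun s => (hmu s).le⟩,
    fun q' hq' => ?_, fun lam' hl' mu' _ => ?_⟩
  · exact (M.lagrangian_le (fun s a => (hQ hq' s a).1) hadv).trans (hval.trans hL.symm).le
  · refine hL.le.trans ?_
    change _ ≤ M.lagrangian q lam' mu'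
    rw [M.lagrangian_of_mem_flowSet hq]
    linarith [mul_nonneg hl'.1 hg]

/-- The primal part of every saddle point solves the occupancy-measure linear program. -/
theorem exists_optimal_value_saddleSet {ξ : ℝ} (hξ : 0 < ξ) (hfeas : M.Feasible ξ) :
    ∃ q ∈ M.flowSet, 0 ≤ statePair M.g q ∧
      (∀ q' ∈ M.flowSet, 0 ≤ statePair M.g q' → statePair M.r q' ≤ statePair M.r q) ∧
      ∀ Q : Set (S → A → ℝ), Q ⊆ M.Qbox → M.flowSet ⊆ Q → ∀ z ∈ M.saddleSet Q ξ,
        z.q ∈ M.flowSet ∧ 0 ≤ statePair M.g z.q ∧ statePair M.r q ≤ statePair M.r z.q := by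
  classical
  obtain ⟨q, hq, lam, mu, hl0, hl1, hmu, hg, hcs, hadv, hval⟩ := M.exists_optimal_triple hξ hfeas
  refine ⟨q, hq, hg, fun q' hq' hg' => ?_, fun Q hQ hQ' z hz => ?_⟩
  · have h := M.lagrangian_le hq'.1 hadv
    rw [M.lagrangian_of_mem_flowSet hq'] at h
    linarith [mul_nonneg hl0 hg']
  have hz0 : ∀ s a, 0 ≤ z.q s a := fun s a => (hQ hz.1.1 s a).1
  have h1 : M.lagrangian z.q lam mu ≤ statePair M.r q := (M.lagrangian_le hz0 hadv).trans hval.le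
  have h2 : statePair M.r q ≤ M.lagrangian z.q z.lam z.mu := by
    refine le_trans ?_ (hz.2.1 q (hQ' hq))
    rw [M.lagrangian_of_mem_flowSet hq]
    linarith [mul_nonneg hz.1.2.1.1 hg]
  -- Sandwiching shows that `(lam, mu)`, from the optimal triple, also minimizes the Lagrangian at
  -- `z.q`. Having slack in the domain, it can be moved up in `lam` and both ways in each `mu s`.
  have hmin : ∀ lam' ∈ M.lamSet ξ, ∀ mu' ∈ M.muSet ξ,
      M.lagrangian z.q lam mu ≤ M.lagrangian z.q lam' mu' ∧
        statePair M.r q ≤ M.lagrangian z.q lam' mu' := fun lam' hl' mu' hm' =>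
    ⟨(h1.trans h2).trans (hz.2.2 lam' hl' mu' hm'), h2.trans (hz.2.2 lam' hl' mu' hm')⟩
  have hlam : lam ∈ M.lamSet ξ := ⟨hl0, hl1.le⟩
  have hmuS : mu ∈ M.muSet ξ := fun s => (hmu s).le
  have hgz : 0 ≤ statePair M.g z.q := by
    have h := (hmin _ ⟨hl0.trans hl1.le, le_rfl⟩ mu hmuS).1
    simp only [lagrangian_eq_add_flowResidual] at h
    refine nonneg_of_mul_nonneg_right (a := 1 / ((1 - M.γ) * ξ) - lam) ?_ (sub_pos.2 hl1)
    linarith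
  have hflow : ∀ s, M.flowResidual z.q s = 0 := by
    intro s
    set B := (1 - M.γ + 1 / ξ) / (1 - M.γ) ^ 2 with hB
    have hupd : ∀ x : ℝ, |x| ≤ B → 0 ≤ (x - mu s) * M.flowResidual z.q s := by
      intro x hx
      have hmem : Function.update mu s x ∈ M.muSet ξ := fun s' => by
        by_cases hs : s' = s
        · rw [hs, Function.update_self]; exact hx
        · rw [Function.update_of_ne hs]; exact (hmu s').le
      have h := (hmin _ hlam _ hmem).1
      simp only [lagrangian_eq_add_flowResidual] at h
      rw [Finset.sum_eq_add_sum_sdiff_singleton_of_mem (Finset.mem_univ s)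
        (fun s' => mu s' * M.flowResidual z.q s'),
        Finset.sum_eq_add_sum_sdiff_singleton_of_mem (Finset.mem_univ s)
        (fun s' => Function.update mu s x s' * M.flowResidual z.q s'),
        Function.update_self] at h
      have e : ∑ s' ∈ Finset.univ \ {s}, Function.update mu s x s' * M.flowResidual z.q s' =
          ∑ s' ∈ Finset.univ \ {s}, mu s' * M.flowResidual z.q s' :=
        Finset.sum_congr rfl fun s' hs' => by rw [Function.update_of_ne (by simpa using hs')]
      linarith
    obtain ⟨hm1, hm2⟩ := abs_lt.1 (hmu s)
    have hB0 : 0 ≤ B := (abs_nonneg _).trans (hmu s).le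
    -- Both endpoints `B` and `-B` are strictly away from `mu s`, so the residual has both signs and
    -- vanishes.
    have hp := hupd B (abs_of_nonneg hB0).le
    have hn := hupd (-B) (by rw [abs_neg, abs_of_nonneg hB0])
    have hp' := nonneg_of_mul_nonneg_right hp (sub_pos.2 hm2)
    have hn' : 0 ≤ -M.flowResidual z.q s :=
      nonneg_of_mul_nonneg_right (a := mu s + B) (by linarith) (by linarith)
    linarith
  have hzf : z.q ∈ M.flowSet := ⟨hz0, hflow⟩
  refine ⟨hzf, hgz, ?_⟩
  have h := (hmin 0 ⟨le_rfl, hl0.trans hl1.le⟩ mu hmuS).2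
  rw [M.lagrangian_of_mem_flowSet hzf] at h
  linarith

/-- Lipschitz constants of the gradient field on the domain are bounded away from zero. -/
theorem exists_pos_le_lipschitz [Nonempty S] [Nonempty A] {ξ : ℝ} (hξ : 0 < ξ)
    {Q : Set (S → A → ℝ)} (hQ : Q.Nonempty) :
    ∃ L₀ : ℝ, 0 < L₀ ∧ ∀ Lf : ℝ≥0, LipschitzOnWith Lf M.gradField (M.domain Q ξ) →
      L₀ ≤ (Lf : ℝ) := by
  obtain ⟨q, hq⟩ := hQ
  have hγ := M.one_sub_γ_pos
  set B := (1 - M.γ + 1 / ξ) / (1 - M.γ) ^ 2 with hB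
  have hBpos : 0 < B := by positivity
  -- Only `z` and `z'` must lie in the domain. The points `w` and `w'` merely encode a test
  -- direction, because `inner_gradField` holds everywhere.
  set q₁ : S → A → ℝ := fun s a => q s a + 1 with hq₁
  set z : PrimalDual S A := mkPrimalDual q 0 fun _ => B
  set z' : PrimalDual S A := mkPrimalDual q 0 fun _ => 0
  set w : PrimalDual S A := mkPrimalDual q₁ 0 fun _ => B
  set w' : PrimalDual S A := mkPrimalDual q₁ 0 fun _ => 0
  have hlam : (0 : ℝ) ∈ M.lamSet ξ := ⟨le_rfl, by positivity⟩
  have hz : z ∈ M.domain Q ξ := ⟨hq, hlam, fun s => (abs_of_pos hBpos).le⟩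
  have hz' : z' ∈ M.domain Q ξ := ⟨hq, hlam, fun s => by
    change |(0 : ℝ)| ≤ B
    rw [abs_zero]
    exact hBpos.le⟩
  have hzw : z - w = z' - w' := by
    ext i
    rcases i with ⟨s, a⟩ | ⟨⟩ | s <;> simp [z, w, z', w', mkPrimalDual]
  have hsum : ∑ s, (M.flowResidual q₁ s - M.flowResidual q s) =
      -((1 - M.γ) * (Fintype.card S * Fintype.card A)) := by
    simp only [flowResidual_sub, hq₁, add_sub_cancel_left, mul_one, Finset.sum_sub_distrib,
      ← Finset.mul_sum]
    have : ∑ s, ∑ s', ∑ a', M.P s' a' s = Fintype.card S * Fintype.card A := by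
      rw [Finset.sum_comm]
      simp_rw [Finset.sum_comm (s := Finset.univ (α := S)) (t := Finset.univ (α := A)), M.P_sum]
      simp [mul_comm]
    rw [this]
    simp
    ring
  have hval : inner ℝ (M.gradField z - M.gradField z') (z - w) =
      -(B * ((1 - M.γ) * (Fintype.card S * Fintype.card A))) := by
    rw [inner_sub_left, inner_gradField, hzw, inner_gradField]
    simp only [lagrangian_eq_add_flowResidual]
    change statePair M.r q₁ + 0 * statePair M.g q₁ + ∑ s, B * M.flowResidual q₁ s
      - (statePair M.r q + 0 * statePair M.g q + ∑ s, B * M.flowResidual q s)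
      - (statePair M.r q₁ + 0 * statePair M.g q₁ + ∑ s, 0 * M.flowResidual q₁ s
      - (statePair M.r q + 0 * statePair M.g q + ∑ s, 0 * M.flowResidual q s)) = _
    rw [← mul_neg, ← hsum]
    simp only [← Finset.mul_sum, Finset.sum_sub_distrib]
    ring
  have hcard : (0 : ℝ) < Fintype.card S * Fintype.card A := by
    have h1 : 0 < Fintype.card S := Fintype.card_pos
    have h2 : 0 < Fintype.card A := Fintype.card_pos
    positivity
  have hδ : 0 < B * ((1 - M.γ) * (Fintype.card S * Fintype.card A)) := by positivity
  set δ := B * ((1 - M.γ) * (Fintype.card S * Fintype.card A))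
  refine ⟨δ / (‖z - z'‖ * ‖z - w‖ + 1), by positivity, fun Lf hL => ?_⟩
  rw [div_le_iff₀ (by positivity)]
  have h1 : ‖M.gradField z - M.gradField z'‖ ≤ Lf * ‖z - z'‖ := by
    simpa [dist_eq_norm] using hL.dist_le_mul z hz z' hz'
  have h2 := neg_le_of_abs_le (abs_real_inner_le_norm (M.gradField z - M.gradField z') (z - w))
  rw [hval] at h2
  have h3 := mul_le_mul_of_nonneg_right h1 (norm_nonneg (z - w))
  have h4 : (0 : ℝ) ≤ Lf := Lf.2
  linarith

theorem opd_mem_domain {Z : Set (PrimalDual S A)} (hc : IsCompact Z) {η : ℝ}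
    {z₁ : PrimalDual S A} (hz₁ : z₁ ∈ Z) (t : ℕ) : M.opd Z η z₁ t ∈ Z := by
  cases t with
  | zero => exact hz₁
  | succ t => exact metricProj_mem hc ⟨z₁, hz₁⟩ _

theorem sum_sum_abs_q_sub_le (z w : PrimalDual S A) :
    ∑ s, ∑ a, |z.q s a - w.q s a| ≤ Fintype.card S * Fintype.card A * ‖z - w‖ := by
  have h : ∀ s a, |z.q s a - w.q s a| ≤ ‖z - w‖ := fun s a => by
    simpa [PrimalDual.q] using PiLp.norm_apply_le (z - w) (Sum.inl (s, a))
  calc ∑ s, ∑ a, |z.q s a - w.q s a| ≤ ∑ _s : S, ∑ _a : A, ‖z - w‖ :=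
        Finset.sum_le_sum fun s _ => Finset.sum_le_sum fun a _ => h s a
    _ = _ := by simp [mul_assoc]

theorem abs_statePair_sub_le {f : S → A → ℝ} (hf : ∀ s a, |f s a| ≤ 1) (q q' : S → A → ℝ) :
    |statePair f q - statePair f q'| ≤ ∑ s, ∑ a, |q s a - q' s a| := by
  simp only [statePair, ← Finset.sum_sub_distrib, ← mul_sub]
  refine (Finset.abs_sum_le_sum_abs _ _).trans (Finset.sum_le_sum fun s _ => ?_)
  refine (Finset.abs_sum_le_sum_abs _ _).trans (Finset.sum_le_sum fun a _ => ?_)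
  rw [abs_mul]
  exact mul_le_of_le_one_left (abs_nonneg _) (hf s a)

/-- The value of a recovered policy is Lipschitz around exact occupancy measures. -/
theorem statePair_sub_le_valueRho_recoveredPolicy {z w : PrimalDual S A}
    (hz : ∀ s a, 0 ≤ z.q s a) (hpos : ∀ s, 0 < ∑ a, z.q s a) (hw : w.q ∈ M.flowSet)
    {f : S → A → ℝ} (hf : ∀ s a, |f s a| ≤ 1) :
    statePair f w.q - (2 / (1 - M.γ) + 1) * (Fintype.card S * Fintype.card A) * ‖z - w‖ ≤
      M.valueRho f (recoveredPolicy z.q) := by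
  have h1 := M.abs_valueRho_recoveredPolicy_sub_le hz hpos hf
  have h2 := M.sum_abs_flowResidual_sub_le z.q w.q
  simp only [hw.2, sub_zero] at h2
  have h3 := abs_statePair_sub_le hf z.q w.q
  have h4 := sum_sum_abs_q_sub_le z w
  have hγ := M.one_sub_γ_pos
  set N := ∑ s, ∑ a, |z.q s a - w.q s a|
  have h5 : (∑ s, |M.flowResidual z.q s|) / (1 - M.γ) ≤ 2 / (1 - M.γ) * N := by
    rw [div_mul_eq_mul_div]
    gcongr
  have h6 : (2 / (1 - M.γ) + 1) * N ≤
      (2 / (1 - M.γ) + 1) * (Fintype.card S * Fintype.card A * ‖z - w‖) := by gcongr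
  have h7 := (abs_le.1 (h1.trans h5)).1
  have h8 := (abs_le.1 h3).1
  linarith

/-- With zero flow violation the approximation error is zero; this turns a linear-program optimum
into an optimal policy. -/
theorem valueRho_recoveredPolicy_of_mem_flowSet {q : S → A → ℝ} (hq : q ∈ M.flowSet)
    (hpos : ∀ s, 0 < ∑ a, q s a) {f : S → A → ℝ} (hf : ∀ s a, |f s a| ≤ 1) :
    M.valueRho f (recoveredPolicy q) = statePair f q := by
  have h := M.abs_valueRho_recoveredPolicy_sub_le hq.1 hpos hf
  simp only [hq.2, abs_zero, Finset.sum_const_zero, zero_div] at h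
  exact sub_eq_zero.1 (abs_nonpos_iff.1 h)

theorem abs_r_le_one (s : S) (a : A) : |M.r s a| ≤ 1 := by
  rw [abs_of_nonneg (M.r_mem s a).1]
  exact (M.r_mem s a).2

theorem sum_pos_of_mem_QboxMin (hρ : 0 < M.rhoMin) {q : S → A → ℝ} (hq : q ∈ M.QboxMin) (s : S) :
    0 < ∑ a, q s a := hρ.trans_le (hq.2 s)

end CMDP

/-! ### Assembly of the theorem and the corollary. -/

theorem mainTheorem7 {S A : Type*} [Fintype S] [Fintype A] (M : CMDP S A)
    (ξ : ℝ) (hξ : 0 < ξ) (hfeas : M.Feasible ξ) :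
    -- linear convergence of the iterates to the saddle points
    ((M.saddleSet M.Qbox ξ).Nonempty ∧
      ∃ C : ℝ, 0 < C ∧
        ∀ Lf : ℝ≥0, LipschitzOnWith Lf M.gradField (M.domain M.Qbox ξ) →
        ∀ η : ℝ, 0 < η → η < 1 / (8 * (Lf : ℝ)) →
        ∀ z₁ ∈ M.domain M.Qbox ξ, ∀ t : ℕ,
          distSq (M.opd (M.domain M.Qbox ξ) η z₁ t) (M.saddleSet M.Qbox ξ) ≤
            64 * distSq z₁ (M.saddleSet M.Qbox ξ) *
              (1 / (1 + min (16 * η ^ 2 * C ^ 2 / 81) (1 / 2))) ^ t) ∧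
    -- near-optimality of the recovered policies
    (0 < M.rhoMin →
      (∃ πs : S → A → ℝ, M.IsOptimalPolicy πs) ∧
      ∃ K : ℝ, 0 < K ∧
        ∀ Lf : ℝ≥0, LipschitzOnWith Lf M.gradField (M.domain M.QboxMin ξ) →
        ∀ η : ℝ, 0 < η → η < 1 / (8 * (Lf : ℝ)) →
        ∀ z₁ ∈ M.domain M.QboxMin ξ,
        ∀ ε : ℝ, 0 < ε → ε ≤ 1 / 2 →
        ∀ t : ℕ, K / η ^ 2 * Real.log (1 / ε) ^ 2 ≤ (t : ℝ) →
          IsPolicy (recoveredPolicy (M.opd (M.domain M.QboxMin ξ) η z₁ t).q) ∧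
          (∀ πs : S → A → ℝ, M.IsOptimalPolicy πs →
            M.valueRho M.r πs -
              M.valueRho M.r (recoveredPolicy (M.opd (M.domain M.QboxMin ξ) η z₁ t).q) ≤ ε) ∧
          -M.valueRho M.g (recoveredPolicy (M.opd (M.domain M.QboxMin ξ) η z₁ t).q) ≤ ε) := by
  have hne := M.saddleSet_nonempty hξ hfeas subset_rfl M.flowSet_subset_Qbox
  refine ⟨⟨hne, (M.opd_linear_convergence subset_rfl (M.isPolyhedral_domain_Qbox ξ) hne).2⟩,
    fun hρ => ?_⟩
  have hQ : M.QboxMin ⊆ M.Qbox := fun q hq => hq.1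
  obtain ⟨q, hq, hg, hopt, hsad⟩ := M.exists_optimal_value_saddleSet hξ hfeas
  have hle : ∀ π : S → A → ℝ, IsPolicy π → M.b ≤ M.valueRho M.u π →
      M.valueRho M.r π ≤ statePair M.r q := fun π hπ hu => by
    rw [M.valueRho_eq_statePair hπ]
    refine hopt _ (M.occupancy_mem_flowSet hπ) ?_
    rw [← M.valueRho_eq_statePair hπ, M.valueRho_g hπ]
    linarith
  constructor
  · have hpos := M.sum_pos_of_mem_QboxMin hρ (M.flowSet_subset_QboxMin hq)
    have hπ := isPolicy_recoveredPolicy hq.1 hpos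
    refine ⟨recoveredPolicy q, hπ, ?_, fun π' hπ' hu => ?_⟩
    · have h := M.valueRho_g hπ
      rw [M.valueRho_recoveredPolicy_of_mem_flowSet hq hpos M.abs_g_le_one] at h
      linarith
    · rw [M.valueRho_recoveredPolicy_of_mem_flowSet hq hpos M.abs_r_le_one]
      exact hle π' hπ' hu
  have hS := M.nonempty_states
  have hA := hfeas.nonempty_actions
  have hne' := M.saddleSet_nonempty hξ hfeas hQ M.flowSet_subset_QboxMin
  have hpoly := M.isPolyhedral_domain_QboxMin ξ
  obtain ⟨hcs, C, hC, hconv⟩ := M.opd_linear_convergence hQ hpoly hne'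
  have hc : IsCompact (M.domain M.QboxMin ξ) :=
    (M.isCompact_domain_Qbox ξ).of_isClosed_subset hpoly.isClosed (M.domain_mono hQ ξ)
  obtain ⟨L₀, hL₀, hLle⟩ := M.exists_pos_le_lipschitz hξ (Q := M.QboxMin)
    ⟨q, M.flowSet_subset_QboxMin hq⟩
  obtain ⟨D, hD⟩ := hc.isBounded.exists_norm_le
  obtain ⟨zs, hzs⟩ := hne'
  have hD0 : 0 ≤ D := (norm_nonneg _).trans (hD zs hzs.1)
  set N : ℝ := (2 / (1 - M.γ) + 1) * (Fintype.card S * Fintype.card A) with hN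
  have hNpos : 0 < N := by
    have h1 : 0 < Fintype.card S := Fintype.card_pos
    have h2 : 0 < Fintype.card A := Fintype.card_pos
    have h3 := M.one_sub_γ_pos
    positivity
  -- `H` is the largest stepsize allowed by `L₀`. `W` combines the squared Lipschitz constant `N` of
  -- the values, the factor 64 of the rate, and a bound on the initial squared distance, so that `K`
  -- depends on neither `Lf` nor the starting point.
  obtain ⟨K, hK, hKt⟩ := exists_iteration_bound hC (H := 1 / (8 * L₀))
    (W := N ^ 2 * (64 * (2 * D + 1) ^ 2)) (by positivity) (by positivity)
  refine ⟨K, hK, fun Lf hL η hη hηL z₁ hz₁ ε hε hε2 t ht => ?_⟩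
  have hηH : η ≤ 1 / (8 * L₀) := by
    refine hηL.le.trans ?_
    have := hLle Lf hL
    gcongr
  have hrate := hconv Lf hL η hη hηL z₁ hz₁ t
  have hbd := hKt η hη hηH ε hε hε2 t ht
  set z := M.opd (M.domain M.QboxMin ξ) η z₁ t with hz
  have hzZ : z ∈ M.domain M.QboxMin ξ := M.opd_mem_domain hc hz₁ t
  set p := metricProj (M.saddleSet M.QboxMin ξ) z with hp
  have hpS : p ∈ M.saddleSet M.QboxMin ξ := metricProj_mem hcs ⟨zs, hzs⟩ z
  have hdz₁ : distSq z₁ (M.saddleSet M.QboxMin ξ) ≤ (2 * D + 1) ^ 2 := by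
    refine (distSq_le hcs z₁ hzs).trans (pow_le_pow_left₀ (norm_nonneg _) ?_ 2)
    linarith [norm_sub_le z₁ zs, hD z₁ hz₁, hD zs hzs.1]
  have hNε : N * ‖z - p‖ ≤ ε := by
    refine le_of_sq_le_sq ?_ hε.le
    calc (N * ‖z - p‖) ^ 2 = N ^ 2 * distSq z (M.saddleSet M.QboxMin ξ) := by
          rw [mul_pow]; rfl
      _ ≤ N ^ 2 * (64 * distSq z₁ (M.saddleSet M.QboxMin ξ) *
          (1 / (1 + min (16 * η ^ 2 * C ^ 2 / 81) (1 / 2))) ^ t) := by gcongr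
      _ ≤ N ^ 2 * (64 * (2 * D + 1) ^ 2 *
          (1 / (1 + min (16 * η ^ 2 * C ^ 2 / 81) (1 / 2))) ^ t) := by gcongr
      _ = N ^ 2 * (64 * (2 * D + 1) ^ 2) *
          (1 / (1 + min (16 * η ^ 2 * C ^ 2 / 81) (1 / 2))) ^ t := by ring
      _ ≤ ε ^ 2 := hbd
  obtain ⟨hpf, hpg, hpr⟩ := hsad _ hQ M.flowSet_subset_QboxMin p hpS
  have hz0 : ∀ s a, 0 ≤ z.q s a := fun s a => (hQ hzZ.1 s a).1
  have hzpos := M.sum_pos_of_mem_QboxMin hρ hzZ.1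
  have hr := M.statePair_sub_le_valueRho_recoveredPolicy hz0 hzpos hpf M.abs_r_le_one
  have hgv := M.statePair_sub_le_valueRho_recoveredPolicy hz0 hzpos hpf M.abs_g_le_one
  refine ⟨isPolicy_recoveredPolicy hz0 hzpos, fun πs hπs => ?_, ?_⟩
  · linarith [hle πs hπs.1 hπs.2.1]
  · linarith
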